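/- Let $n\ge 1$. For $f\in L^1_{loc}(\mathbb R^n)$ let $$M^I f(x)=\sup\Big\{\frac1{|B(z,r)|}\int_{B(z,r)}|f(y)|\,dy \;:\; z\in\mathbb R^n,\ r>0,\ x\in B(z,r),\ r\le |x|/4\Big\}\in[0,\infty]$$ (the supremum of the empty set, which occurs only at $x=0$, is $0$), where $B(z,r)$ is the open ball. There is a constant $C_n$, depending only on $n$, such that the following holds. Let $f\in W^{1,1}(\mathbb R^n)$ be real-valued, i.e. $f\in L^1(\mathbb R^n)$ has a weak gradient $Df\in L^1(\mathbb R^n;\mathbb R^n)$, and let $f$ be radial, i.e. for some $g$ it holds that $f(x)=g(|x|)$ for almost every $x$. Then $M^I f$ is finite almost everywhere and locally integrable, it is weakly differentiable on $\mathbb R^n$ with $DM^I f\in L^1(\mathbb R^n;\mathbb R^n)$ (that is, $M^I f\in W^{1,1}_{loc}(\mathbb R^n)$ with globally integrable weak gradient), and $$\|DM^I f\|_{L^1(\mathbb R^n)}\le C_n\|Df\|_{L^1(\mathbb R^n)}.$$ -/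

import Mathlib

open MeasureTheory Metric
open scoped ENNReal ContDiff

/-- `G` is a weak gradient of the locally integrable function `f : ℝⁿ → ℝ`: `G` is a locally
integrable vector field with `∫ f ∂ᵥφ = - ∫ (G · v) φ` for every test function `φ` and every
direction `v`. -/
structure HasWeakGradient {n : ℕ} (f : EuclideanSpace ℝ (Fin n) → ℝ)
    (G : EuclideanSpace ℝ (Fin n) → EuclideanSpace ℝ (Fin n)) : Prop where
  locallyIntegrable : LocallyIntegrable f volume
  locallyIntegrable_grad : LocallyIntegrable G volume
  integral_eq : ∀ φ : EuclideanSpace ℝ (Fin n) → ℝ, ContDiff ℝ ∞ φ → HasCompactSupport φ →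
    ∀ v : EuclideanSpace ℝ (Fin n),
      ∫ x, f x * fderiv ℝ φ x v = -∫ x, inner ℝ (G x) v * φ x

/-- `f` is radial, as an element of a space of functions modulo equality almost everywhere. -/
def IsRadial {n : ℕ} (f : EuclideanSpace ℝ (Fin n) → ℝ) : Prop :=
  ∃ g : ℝ → ℝ, ∀ᵐ x : EuclideanSpace ℝ (Fin n), f x = g ‖x‖

/-- The restricted maximal function: the supremum of the averages of `|f|` over the open balls
`B(z, r)` that contain `x` and have radius `r ≤ |x| / 4`. It is valued in `[0, ∞]`. -/
noncomputable def restrictedMaximal {n : ℕ} (f : EuclideanSpace ℝ (Fin n) → ℝ)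
    (x : EuclideanSpace ℝ (Fin n)) : ℝ≥0∞ :=
  ⨆ (z : EuclideanSpace ℝ (Fin n)) (r : ℝ) (_ : x ∈ ball z r) (_ : r ≤ ‖x‖ / 4),
    ⨍⁻ y in ball z r, ‖f y‖ₑ ∂volume

/-!
The theorem reduces to an estimate on the line. In the coordinate `s = log ‖x‖`, a radial function
is given by a profile, and a ball that meets the sphere of radius `e ^ s` and has radius at most
`e ^ s / 4` is `e ^ s • B(ζ, ρ)` with `|‖ζ‖ - 1| ≤ ρ ≤ 1 / 4` (`admissibleBalls`). Such a ball stays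
within distance `1` of `s` in the logarithmic coordinate, so that everything is local on the line,
at unit scale. The maximal function at `x` is `logMaximal volume Γ 0 (log ‖x‖)`, where `Γ` is the
absolute value of the profile (`restrictedMaximal_eq_ofReal_logMaximal`).

A radial Sobolev function has an absolutely continuous profile, whose derivative `γ` is integrable
with weight `e ^ ((n - 1) s)`, with norm at most a multiple of that of the gradient
(`HasWeakGradient.exists_log_profile`). Conversely, an absolutely continuous profile whose
derivative is integrable with this weight defines a weakly differentiable function; the origin is
no obstacle, not even in dimension `1`, because the profile enters through the divergence theorem
on balls centred at the origin (`hasWeakGradient_of_log_profile`). As the weight is essentially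
constant on bounded intervals, it suffices to bound the variation of the maximal function on a unit
interval by the integral of `|γ|` over a larger interval.

Averages over balls of relative radius at least `1 / 8` are convolutions of `Γ` with bounded
densities, hence they are Lipschitz with the right constant, and so is their supremum
(`exists_abs_logMaximal_sub_le`). Small balls are handled without any estimate: if the maximal
function `M` at `s` is attained at a ball of relative radius less than `1 / 8`, this ball contains
points at which `Γ` is at least `M s`, and it remains admissible, so that `M` is at least `M s`, for
all radii on the way to such a point (`logAverage_le_logMaximal_of_mem_uIcc`). Therefore `M` has no
strict local maximum where it exceeds the maximum of `Γ` and of the maximal function over the large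
balls, and its variation is at most the variation of that maximum
(`eVariationOn_le_of_forall_exists_majorant`).

Bounded variation alone does not exclude jumps or a Cantor part of the derivative. For this, all
of the above is applied to the truncations `max M (Γ + δ)`. These are absolutely continuous, as
averages over very small balls are less than `Γ + δ` by uniform continuity. As `δ → 0` their
derivatives converge to the derivative of `M` where `M > Γ`, and to that of `Γ` where `M = Γ`, with
domination, and the bounds are uniform in `δ` (`exists_logMaximal_sub_eq_integral`).
-/

section

open Set Filter Topology

/-! ### Variation of functions without strict local maxima -/

/-- A function `M ≥ h` varies no more than `h` if it has no strict local maximum where it exceeds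
`h`: from every point `s` one reaches a point `t` with `M s ≤ h t` along which `M` stays at least
`M s`. Here `V` controls the increments of `h` on an interval `[c, d]` that may be larger than
`[a, b]`, since `t` may lie outside of `[a, b]`. -/
theorem sum_abs_sub_le_of_forall_exists_majorant {M h V : ℝ → ℝ} {a b c d : ℝ} (hac : c ≤ a)
    (hbd : b ≤ d) (hhM : ∀ x ∈ Icc a b, h x ≤ M x)
    (hV : ∀ p ∈ Icc c d, ∀ q ∈ Icc c d, p ≤ q → |h q - h p| ≤ V q - V p)
    (hM : ∀ s ∈ Icc a b, ∃ t ∈ Icc c d, M s ≤ h t ∧ ∀ τ ∈ Icc a b, τ ∈ uIcc s t → M s ≤ M τ)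
    {u : ℕ → ℝ} (hu : Monotone u) (hus : ∀ i, u i ∈ Icc a b) (N : ℕ) :
    ∑ i ∈ Finset.range N, |M (u (i + 1)) - M (u i)| ≤ V d - V c := by
  have hsub : ∀ {x}, x ∈ Icc a b → x ∈ Icc c d := fun hx => ⟨hac.trans hx.1, hx.2.trans hbd⟩
  have hc : c ∈ Icc c d := ⟨le_rfl, hac.trans ((hus 0).1.trans ((hus 0).2.trans hbd))⟩
  have hd : d ∈ Icc c d := ⟨hc.2, le_rfl⟩
  have hVc : ∀ p ∈ Icc c d, V c ≤ V p := fun p hp => by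
    have := (abs_nonneg _).trans (hV c hc p hp hp.1); linarith
  have hVd : ∀ p ∈ Icc c d, V p ≤ V d := fun p hp => by
    have := (abs_nonneg _).trans (hV p hp d hd hp.2); linarith
  -- Follow the maximal monotone runs of `M` along the partition. Either nothing has moved yet, or
  -- the current run descends to `u N` from below a value `h p`, or it ascends to `u N` from a value
  -- `M p`. Peaks are dominated by a value `h t` and valleys lie above `h`, so that every completed
  -- run is paid for by the variation of `h` between the corresponding points, and these points
  -- appear in increasing order.
  have key : ∀ N : ℕ,
      (∑ i ∈ Finset.range N, |M (u (i + 1)) - M (u i)| = 0) ∨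
      (∃ p ∈ Icc c d, p ≤ u N ∧ M (u N) ≤ h p ∧
        ∑ i ∈ Finset.range N, |M (u (i + 1)) - M (u i)| ≤ V p - V c + (h p - M (u N))) ∨
      (∃ p ∈ Icc a b, p ≤ u N ∧ M p < M (u N) ∧
        ∑ i ∈ Finset.range N, |M (u (i + 1)) - M (u i)| ≤ V p - V c + (M (u N) - M p)) := by
    intro N
    induction N with
    | zero => left; simp
    | succ N ih =>
      rw [Finset.sum_range_succ]
      set S := ∑ i ∈ Finset.range N, |M (u (i + 1)) - M (u i)|
      have hN := hus N
      have hN1 := hus (N + 1)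
      have hle : u N ≤ u (N + 1) := hu (Nat.le_succ N)
      obtain ⟨t, ht, hMt, hbetween⟩ := hM (u N) hN
      -- If `M` decreases in the next step, the point `t` that dominates `M (u N)` comes before
      -- `u (N + 1)`.
      have htlt : M (u (N + 1)) < M (u N) → t ≤ u (N + 1) := by
        intro hlt
        by_contra! hcon
        have := hbetween _ hN1 (by rw [uIcc_of_le (hle.trans hcon.le)]; exact ⟨hle, hcon.le⟩)
        linarith
      rcases ih with h0 | ⟨p, hp, hpN, hMp, hS⟩ | ⟨p, hp, hpN, hMp, hS⟩
      · rcases lt_trichotomy (M (u N)) (M (u (N + 1))) with hlt | heq | hgt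
        · right; right
          refine ⟨u N, hN, hle, hlt, ?_⟩
          rw [h0, abs_of_pos (by linarith)]
          linarith [hVc _ (hsub hN)]
        · left; rw [h0, heq]; simp
        · right; left
          refine ⟨t, ht, htlt hgt, by linarith, ?_⟩
          rw [h0, abs_of_neg (by linarith)]
          linarith [hVc _ ht]
      · rcases le_or_gt (M (u (N + 1))) (M (u N)) with hle' | hgt
        · right; left
          refine ⟨p, hp, hpN.trans hle, by linarith, ?_⟩
          rw [abs_of_nonpos (by linarith)]; linarith
        · right; right
          refine ⟨u N, hN, hle, hgt, ?_⟩
          rw [abs_of_pos (by linarith)]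
          have h1 := hV p hp _ (hsub hN) hpN
          have h2 := neg_abs_le (h (u N) - h p)
          have h3 := hhM _ hN
          linarith
      · rcases le_or_gt (M (u N)) (M (u (N + 1))) with hle' | hgt
        · right; right
          refine ⟨p, hp, hpN.trans hle, by linarith, ?_⟩
          rw [abs_of_nonneg (by linarith)]; linarith
        · right; left
          -- It does not come before the last valley `p` either.
          have hpt : p ≤ t := by
            by_contra! hcon
            have := hbetween p hp (by rw [uIcc_of_ge (hcon.le.trans hpN)]; exact ⟨hcon.le, hpN⟩)
            linarith
          refine ⟨t, ht, htlt hgt, by linarith, ?_⟩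
          rw [abs_of_neg (by linarith)]
          have h1 := hV p (hsub hp) t ht hpt
          have h2 := le_abs_self (h t - h p)
          have h3 := hhM _ hp
          linarith
  rcases key N with h0 | ⟨p, hp, hpN, hMp, hS⟩ | ⟨p, hp, hpN, hMp, hS⟩
  · rw [h0]; linarith [hVc d hd]
  · have h1 := hV p hp _ (hsub (hus N)) hpN
    have h2 := neg_abs_le (h (u N) - h p)
    have h3 := hhM _ (hus N)
    linarith [hVd _ (hsub (hus N))]
  · obtain ⟨t, ht, hMt, hbetween⟩ := hM (u N) (hus N)
    have hpt : p ≤ t := by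
      by_contra! hcon
      have := hbetween p hp (by rw [uIcc_of_ge (hcon.le.trans hpN)]; exact ⟨hcon.le, hpN⟩)
      linarith
    have h1 := hV p (hsub hp) t ht hpt
    have h2 := le_abs_self (h t - h p)
    have h3 := hhM _ hp
    linarith [hVd _ ht]

theorem eVariationOn_le_of_forall_exists_majorant {M h V : ℝ → ℝ} {a b c d : ℝ} (hac : c ≤ a)
    (hbd : b ≤ d) (hhM : ∀ x ∈ Icc a b, h x ≤ M x)
    (hV : ∀ p ∈ Icc c d, ∀ q ∈ Icc c d, p ≤ q → |h q - h p| ≤ V q - V p)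
    (hM : ∀ s ∈ Icc a b, ∃ t ∈ Icc c d, M s ≤ h t ∧ ∀ τ ∈ Icc a b, τ ∈ uIcc s t → M s ≤ M τ) :
    eVariationOn M (Icc a b) ≤ ENNReal.ofReal (V d - V c) := by
  refine iSup_le fun ⟨N, u, hu, hus⟩ => ?_
  have := sum_abs_sub_le_of_forall_exists_majorant hac hbd hhM hV hM hu hus N
  refine le_trans (le_of_eq ?_) (ENNReal.ofReal_le_ofReal this)
  rw [ENNReal.ofReal_sum_of_nonneg fun _ _ => abs_nonneg _]
  exact Finset.sum_congr rfl fun i _ => by rw [edist_dist, Real.dist_eq]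

/-- Comparison of `|f'|` with the derivative of the monotone variation function of `f`. -/
theorem lintegral_enorm_deriv_le_eVariationOn {f : ℝ → ℝ} {a b : ℝ} (hab : a ≤ b)
    (hf : BoundedVariationOn f (Icc a b)) :
    ∫⁻ x in Icc a b, ‖deriv f x‖ₑ ≤ eVariationOn f (Icc a b) := by
  have hl := hf.locallyBoundedVariationOn
  have ha : a ∈ Icc a b := left_mem_Icc.2 hab
  have hb : b ∈ Icc a b := right_mem_Icc.2 hab
  set V := variationOnFromTo f (Icc a b) a with hVdef
  have hVm : MonotoneOn V (Icc a b) := variationOnFromTo.monotoneOn hl ha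
  have hle : ∀ p ∈ Icc a b, ∀ q ∈ Icc a b, p ≤ q → |f q - f p| ≤ V q - V p := by
    intro p hp q hq hpq
    have h2 : V q - V p = variationOnFromTo f (Icc a b) p q := by
      have := variationOnFromTo.add hl ha hp hq
      simp only [hVdef]; linarith
    rw [h2, variationOnFromTo.eq_of_le _ _ hpq, ← Real.dist_eq, ← ENNReal.ofReal_le_iff_le_toReal,
      ← edist_dist]
    · exact eVariationOn.edist_le _ ⟨hq, hpq, le_rfl⟩ ⟨hp, le_rfl, hpq⟩
    · exact hl p q hp hq
  have hVi : IntervalIntegrable (deriv V) volume a b :=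
    MonotoneOn.intervalIntegrable_deriv (by rwa [uIcc_of_le hab])
  have hVint : ∫ x in a..b, deriv V x ≤ V b - V a := by
    have h1 := MonotoneOn.intervalIntegral_deriv_mem_uIcc (f := V) (a := a) (b := b)
      (by rwa [uIcc_of_le hab])
    rw [uIcc_of_le (by linarith [hVm ha hb hab])] at h1
    exact h1.2
  have hpt : ∀ᵐ x ∂volume.restrict (Ioc a b), ‖deriv f x‖ ≤ deriv V x := by
    rw [← restrict_Ioo_eq_restrict_Ioc, ae_restrict_iff' measurableSet_Ioo]
    filter_upwards [hl.ae_differentiableWithinAt_of_mem, hVm.ae_differentiableWithinAt_of_mem]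
      with x hx1 hx2 hx
    have hn : Icc a b ∈ 𝓝 x := Icc_mem_nhds hx.1 hx.2
    have d1 := ((hx1 (Ioo_subset_Icc_self hx)).differentiableAt hn).hasDerivAt
    have d2 := ((hx2 (Ioo_subset_Icc_self hx)).differentiableAt hn).hasDerivAt
    have t1 := (hasDerivAt_iff_tendsto_slope.1 d1).mono_left (nhdsGT_le_nhdsNE x)
    have t2 := (hasDerivAt_iff_tendsto_slope.1 d2).mono_left (nhdsGT_le_nhdsNE x)
    refine le_of_tendsto_of_tendsto t1.norm t2 ?_
    have : ∀ᶠ y in 𝓝[>] x, y ∈ Ioo x b := Ioo_mem_nhdsGT hx.2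
    filter_upwards [this] with y hy
    have := hle x (Ioo_subset_Icc_self hx) y ⟨(hx.1.trans hy.1).le, hy.2.le⟩ hy.1.le
    rw [slope_def_field, slope_def_field, norm_div, Real.norm_eq_abs, Real.norm_eq_abs,
      abs_of_pos (sub_pos.2 hy.1)]
    exact div_le_div_of_nonneg_right this (sub_pos.2 hy.1).le
  have hVb : ENNReal.ofReal (V b - V a) = eVariationOn f (Icc a b) := by
    simp only [hVdef, variationOnFromTo.self, sub_zero, variationOnFromTo.eq_of_le _ _ hab,
      inter_self]
    exact ENNReal.ofReal_toReal hf
  rw [← hVb]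
  calc ∫⁻ x in Icc a b, ‖deriv f x‖ₑ = ∫⁻ x in Ioc a b, ‖deriv f x‖ₑ := by
        rw [restrict_Ioc_eq_restrict_Icc]
    _ ≤ ∫⁻ x in Ioc a b, ENNReal.ofReal (deriv V x) := by
        refine lintegral_mono_ae ?_
        filter_upwards [hpt] with x hx
        rw [← ofReal_norm]
        exact ENNReal.ofReal_le_ofReal hx
    _ = ENNReal.ofReal (∫ x in Ioc a b, deriv V x) := by
        rw [ofReal_integral_eq_lintegral_ofReal]
        · exact (intervalIntegrable_iff_integrableOn_Ioc_of_le hab).1 hVi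
        · filter_upwards [hpt] with x hx using (norm_nonneg _).trans hx
    _ ≤ ENNReal.ofReal (V b - V a) := by
        rw [← intervalIntegral.integral_of_le hab]
        exact ENNReal.ofReal_le_ofReal hVint

theorem absolutelyContinuousOnInterval_of_abs_sub_le {f k : ℝ → ℝ} {a b : ℝ} (hab : a ≤ b)
    (hk : IntervalIntegrable k volume a b)
    (hf : ∀ p ∈ Icc a b, ∀ q ∈ Icc a b, p ≤ q → |f q - f p| ≤ ∫ x in p..q, k x) :
    AbsolutelyContinuousOnInterval f a b := by
  have hF := hk.absolutelyContinuousOnInterval_intervalIntegral left_mem_uIcc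
  rw [absolutelyContinuousOnInterval_iff] at hF ⊢
  intro ε hε
  obtain ⟨δ, hδ, H⟩ := hF ε hε
  refine ⟨δ, hδ, fun E hE hE2 => lt_of_le_of_lt (Finset.sum_le_sum fun i hi => ?_) (H E hE hE2)⟩
  have hmem := hE.1 i hi
  rw [uIcc_of_le hab] at hmem
  have hii : ∀ x ∈ Icc a b, IntervalIntegrable k volume a x := fun x hx =>
    hk.mono_set (by rw [uIcc_of_le hab, uIcc_of_le hx.1]; exact Icc_subset_Icc_right hx.2)
  have key : ∀ p ∈ Icc a b, ∀ q ∈ Icc a b, p ≤ q →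
      dist (f p) (f q) ≤ dist (∫ x in a..p, k x) (∫ x in a..q, k x) := by
    intro p hp q hq hpq
    rw [dist_comm, dist_comm (∫ x in a..p, k x), Real.dist_eq, Real.dist_eq,
      intervalIntegral.integral_interval_sub_left (hii q hq) (hii p hp)]
    exact (hf p hp q hq hpq).trans (le_abs_self _)
  rcases le_total (E.2 i).1 (E.2 i).2 with h | h
  · exact key _ hmem.1 _ hmem.2 h
  · rw [dist_comm, dist_comm (∫ x in a..(E.2 i).1, k x)]
    exact key _ hmem.2 _ hmem.1 h

/-! ### Weak derivatives on the line -/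

/-- The primitive of a test function that vanishes near `-∞`. It is constant near `+∞`, and a test
function if the integral is zero. -/
theorem exists_primitive_of_hasCompactSupport {ψ : ℝ → ℝ} (hψ : ContDiff ℝ ∞ ψ)
    (hc : HasCompactSupport ψ) :
    ∃ P : ℝ → ℝ, ContDiff ℝ ∞ P ∧ (∀ x, HasDerivAt P (ψ x) x) ∧
      ∃ R > 0, (∀ x ≤ -R, P x = 0) ∧ (∀ x, R ≤ x → P x = ∫ t, ψ t) ∧
        ∀ x, R ≤ |x| → ψ x = 0 := by
  obtain ⟨R, hR, hsub⟩ : ∃ R > 0, ∀ x, R ≤ |x| → ψ x = 0 := hc.exists_pos_le_norm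
  have hcont := hψ.continuous
  have hsupp : Function.support ψ ⊆ Ioc (-R) R := by
    intro x hx
    by_contra hcon
    refine hx (hsub x ?_)
    by_contra! hlt
    rw [abs_lt] at hlt
    exact hcon ⟨hlt.1, hlt.2.le⟩
  have hd : ∀ x, HasDerivAt (fun x => ∫ t in (-R)..x, ψ t) (ψ x) x := fun x =>
    intervalIntegral.integral_hasDerivAt_right (hcont.intervalIntegrable _ _)
      (hcont.stronglyMeasurableAtFilter _ _) hcont.continuousAt
  refine ⟨fun x => ∫ t in (-R)..x, ψ t, ?_, hd, R, hR, fun x hx => ?_, fun x hx => ?_, hsub⟩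
  · rw [contDiff_infty_iff_deriv]
    exact ⟨fun x => (hd x).differentiableAt, by rwa [funext fun x => (hd x).deriv]⟩
  · refine intervalIntegral.integral_zero_ae (Eventually.of_forall fun t ht => hsub t ?_)
    rw [uIoc_of_ge hx] at ht
    rw [abs_of_nonpos (by linarith [ht.2])]; linarith [ht.2]
  · refine intervalIntegral.integral_eq_integral_of_support_subset ?_
    exact hsupp.trans (Ioc_subset_Ioc_right hx)

theorem integral_primitive_mul_deriv {g ψ : ℝ → ℝ} (hg : LocallyIntegrable g volume)
    (hψ : ContDiff ℝ ∞ ψ) (hc : HasCompactSupport ψ) :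
    ∫ x, (∫ t in (0 : ℝ)..x, g t) * deriv ψ x = -∫ x, g x * ψ x := by
  obtain ⟨R, hR, hsub⟩ : ∃ R > 0, ∀ x, R ≤ |x| → ψ x = 0 := hc.exists_pos_le_norm
  have hgi : ∀ a b, IntervalIntegrable g volume a b := fun a b =>
    (hg.integrableOn_isCompact isCompact_uIcc).intervalIntegrable
  have hG : AbsolutelyContinuousOnInterval (fun x => ∫ t in (0 : ℝ)..x, g t) (-(R+1)) (R+1) :=
    (hgi _ _).absolutelyContinuousOnInterval_intervalIntegral
      (by rw [uIcc_of_le (by linarith)]; constructor <;> linarith)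
  have hP : AbsolutelyContinuousOnInterval ψ (-(R+1)) (R+1) :=
    ((hψ.of_le (by norm_cast)).contDiffOn).absolutelyContinuousOnInterval
  have hz : ∀ x, x ∉ Ioc (-(R + 1)) (R + 1) → R + 1 ≤ |x| := by
    intro x hx
    by_contra! hlt
    rw [abs_lt] at hlt
    exact hx ⟨hlt.1, hlt.2.le⟩
  have hdz : ∀ x, R + 1 ≤ |x| → deriv ψ x = 0 := by
    intro x hx
    have : ψ =ᶠ[𝓝 x] fun _ => 0 := by
      have : ∀ᶠ y in 𝓝 x, R < |y| := (continuous_abs.tendsto x).eventually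
        (lt_mem_nhds (by linarith))
      filter_upwards [this] with y hy using hsub y hy.le
    rw [this.deriv_eq]; simp
  have h1 := hG.integral_mul_deriv_eq_deriv_mul hP
  rw [hsub (R + 1) (by rw [abs_of_pos] <;> linarith),
    hsub (-(R + 1)) (by rw [abs_neg, abs_of_pos] <;> linarith)] at h1
  have e1 : ∫ x in (-(R + 1))..(R + 1), (∫ t in (0 : ℝ)..x, g t) * deriv ψ x =
      ∫ x, (∫ t in (0 : ℝ)..x, g t) * deriv ψ x := by
    refine intervalIntegral.integral_eq_integral_of_support_subset fun x hx => ?_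
    by_contra hcon
    exact hx (by simp [hdz x (hz x hcon)])
  have e2 : ∫ x in (-(R + 1))..(R + 1), deriv (fun x => ∫ t in (0 : ℝ)..x, g t) x * ψ x =
      ∫ x in (-(R + 1))..(R + 1), g x * ψ x := by
    refine intervalIntegral.integral_congr_ae ?_
    filter_upwards [LocallyIntegrable.ae_hasDerivAt_integral hg] with x hx _
    rw [(hx 0).deriv]
  have e3 : ∫ x in (-(R + 1))..(R + 1), g x * ψ x = ∫ x, g x * ψ x := by
    refine intervalIntegral.integral_eq_integral_of_support_subset fun x hx => ?_
    by_contra hcon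
    exact hx (by simp [hsub x (by linarith [hz x hcon])])
  rw [e1, e2, e3] at h1
  linarith

/-- The lemma of du Bois-Reymond. -/
theorem exists_ae_eq_const_of_integral_mul_deriv_eq_zero {d : ℝ → ℝ}
    (hd : LocallyIntegrable d volume)
    (h : ∀ ψ : ℝ → ℝ, ContDiff ℝ ∞ ψ → HasCompactSupport ψ → ∫ x, d x * deriv ψ x = 0) :
    ∃ c, ∀ᵐ x, d x = c := by
  let b : ContDiffBump (0 : ℝ) := ⟨1, 2, one_pos, one_lt_two⟩
  set χ : ℝ → ℝ := b.normed volume with hχ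
  have hχs : ContDiff ℝ ∞ χ := b.contDiff_normed
  have hχc : HasCompactSupport χ := b.hasCompactSupport_normed
  have hχ1 : ∫ x, χ x = 1 := b.integral_normed
  have hint : ∀ φ : ℝ → ℝ, Continuous φ → HasCompactSupport φ → Integrable (fun x => φ x * d x) :=
    fun φ h1 h2 => hd.integrable_smul_left_of_hasCompactSupport h1 h2
  refine ⟨∫ x, χ x * d x, ?_⟩
  -- A test function `φ` minus `(∫ φ) χ` is the derivative of a test function.
  refine ae_eq_of_integral_contDiff_smul_eq hd (continuous_const.locallyIntegrable) ?_
  intro φ hφ hφc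
  set I := ∫ x, φ x
  set η : ℝ → ℝ := fun x => φ x - I * χ x with hη
  have hηs : ContDiff ℝ ∞ η := hφ.sub (contDiff_const.mul hχs)
  have hηc : HasCompactSupport η := by
    have : HasCompactSupport fun x => I * χ x := hχc.mul_left
    exact hφc.sub this
  have hφi : Integrable φ := hφ.continuous.integrable_of_hasCompactSupport hφc
  have hχi : Integrable χ := hχs.continuous.integrable_of_hasCompactSupport hχc
  have hη0 : ∫ x, η x = 0 := by
    simp only [hη]
    rw [integral_sub hφi (hχi.const_mul I), integral_const_mul, hχ1]
    simp [I]
  obtain ⟨P, hP, hPd, R, hR, hl, hr, -⟩ := exists_primitive_of_hasCompactSupport hηs hηc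
  have hPc : HasCompactSupport P := by
    refine HasCompactSupport.intro (isCompact_Icc (a := -R) (b := R)) fun x hx => ?_
    rw [mem_Icc, not_and_or, not_le, not_le] at hx
    rcases hx with hx | hx
    · exact hl x hx.le
    · rw [hr x hx.le, hη0]
  have := h P hP hPc
  rw [funext fun x => (hPd x).deriv] at this
  have e1 : ∫ x, d x * η x = (∫ x, φ x * d x) - I * ∫ x, χ x * d x := by
    rw [← integral_const_mul, ← integral_sub (hint φ hφ.continuous hφc)
      ((hint χ hχs.continuous hχc).const_mul I)]
    refine integral_congr_ae (Eventually.of_forall fun x => ?_)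
    simp only [hη]; ring
  simp only [smul_eq_mul]
  rw [integral_mul_const]
  linarith

theorem exists_ae_eq_add_integral_of_weak_deriv {f g : ℝ → ℝ} (hf : LocallyIntegrable f volume)
    (hg : LocallyIntegrable g volume)
    (h : ∀ ψ : ℝ → ℝ, ContDiff ℝ ∞ ψ → HasCompactSupport ψ →
      ∫ x, f x * deriv ψ x = -∫ x, g x * ψ x) :
    ∃ c, ∀ᵐ x, f x = c + ∫ t in (0 : ℝ)..x, g t := by
  have hcont : Continuous fun x => ∫ t in (0 : ℝ)..x, g t :=
    intervalIntegral.continuous_primitive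
      (fun a b => (hg.integrableOn_isCompact isCompact_uIcc).intervalIntegrable) 0
  suffices H : ∃ c, ∀ᵐ x, (fun x => f x - ∫ t in (0 : ℝ)..x, g t) x = c by
    obtain ⟨c, hc⟩ := H
    refine ⟨c, ?_⟩
    filter_upwards [hc] with x hx
    linarith
  refine exists_ae_eq_const_of_integral_mul_deriv_eq_zero (hf.sub hcont.locallyIntegrable) ?_
  intro ψ hψ hψc
  have hdc : Continuous (deriv ψ) := hψ.continuous_deriv (by norm_cast)
  have i1 : Integrable fun x => deriv ψ x * f x :=
    hf.integrable_smul_left_of_hasCompactSupport hdc hψc.deriv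
  have i2 : Integrable fun x => deriv ψ x * ∫ t in (0 : ℝ)..x, g t :=
    hcont.locallyIntegrable.integrable_smul_left_of_hasCompactSupport hdc hψc.deriv
  have : ∀ x, (f x - ∫ t in (0 : ℝ)..x, g t) * deriv ψ x =
      deriv ψ x * f x - deriv ψ x * ∫ t in (0 : ℝ)..x, g t := fun x => by ring
  simp_rw [this]
  rw [integral_sub i1 i2]
  simp_rw [mul_comm (deriv ψ _)]
  rw [h ψ hψ hψc, integral_primitive_mul_deriv hg hψ hψc, sub_self]

/-! ### Logarithmic polar coordinates -/

section LogPolar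

variable {E : Type*} [NormedAddCommGroup E] [NormedSpace ℝ E]

variable (E) in
/-- The measure `e ^ (n s) ds` on the line, where `n` is the dimension of `E`: the radial part of
Lebesgue measure on `E` in the coordinate `s = log ‖x‖`. -/
noncomputable def logRadialMeasure : Measure ℝ :=
  volume.withDensity fun s => ENNReal.ofReal (Real.exp (Module.finrank ℝ E * s))

instance : SigmaFinite (logRadialMeasure E) :=
  SigmaFinite.withDensity_ofReal _

theorem ae_volume_iff_ae_logRadialMeasure {p : ℝ → Prop} :
    (∀ᵐ s ∂logRadialMeasure E, p s) ↔ ∀ᵐ s, p s := by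
  have h1 : logRadialMeasure E ≪ volume := withDensity_absolutelyContinuous _ _
  have h2 : volume ≪ logRadialMeasure E := by
    refine withDensity_absolutelyContinuous' (by fun_prop) (Eventually.of_forall fun s => ?_)
    simp [Real.exp_pos]
  exact ⟨fun h => h2.ae_le h, fun h => h1.ae_le h⟩

theorem norm_exp_smul_sphere (s : ℝ) (θ : sphere (0 : E) 1) :
    ‖Real.exp s • (θ : E)‖ = Real.exp s := by
  simp [norm_smul]

variable [FiniteDimensional ℝ E] [MeasurableSpace E] [BorelSpace E]

theorem lintegral_eq_lintegral_exp_smul_sphere [Nontrivial E] (μ : Measure E) [μ.IsAddHaarMeasure]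
    {F : E → ℝ≥0∞} (hF : Measurable F) :
    ∫⁻ x, F x ∂μ = ∫⁻ p : ℝ × sphere (0 : E) 1, F (Real.exp p.1 • (p.2 : E))
      ∂(logRadialMeasure E).prod μ.toSphere := by
  have hmeas : Measurable fun p : ℝ × sphere (0 : E) 1 => F (Real.exp p.1 • (p.2 : E)) :=
    hF.comp (by fun_prop)
  have hn : 0 < Module.finrank ℝ E := Module.finrank_pos
  have e1 : ∫⁻ x, F x ∂μ = ∫⁻ x : ({0}ᶜ : Set E), F x ∂(μ.comap (↑)) := by
    rw [lintegral_subtype_comap (measurableSet_singleton _).compl, restrict_compl_singleton]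
  have e2 : ∫⁻ x : ({0}ᶜ : Set E), F x ∂(μ.comap (↑)) =
      ∫⁻ q : sphere (0 : E) 1 × Ioi (0 : ℝ), F ((q.2 : ℝ) • (q.1 : E))
        ∂(μ.toSphere.prod (Measure.volumeIoiPow (Module.finrank ℝ E - 1))) := by
    have hm : Measurable fun q : sphere (0 : E) 1 × Ioi (0 : ℝ) => F ((q.2 : ℝ) • (q.1 : E)) :=
      hF.comp (by fun_prop)
    rw [← μ.measurePreserving_homeomorphUnitSphereProd.lintegral_comp hm]
    refine lintegral_congr fun x => ?_
    have hx : ‖(x : E)‖ ≠ 0 := norm_ne_zero_iff.2 x.2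
    simp [smul_smul, hx]
  rw [e1, e2, lintegral_prod _ (by fun_prop), lintegral_prod_symm' _ hmeas]
  refine lintegral_congr fun θ => ?_
  have hg : Measurable fun r : ℝ => F (r • (θ : E)) := hF.comp (by fun_prop)
  rw [Measure.volumeIoiPow, lintegral_withDensity_eq_lintegral_mul _ (by fun_prop) (by fun_prop)]
  simp only [Pi.mul_apply]
  rw [lintegral_subtype_comap measurableSet_Ioi
    (fun r : ℝ => ENNReal.ofReal (r ^ (Module.finrank ℝ E - 1)) * F (r • (θ : E)))]
  rw [← Real.range_exp, ← image_univ, lintegral_image_eq_lintegral_abs_deriv_mul MeasurableSet.univ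
    (fun x _ => (Real.hasDerivAt_exp x).hasDerivWithinAt) Real.exp_injective.injOn,
    logRadialMeasure, lintegral_withDensity_eq_lintegral_mul _ (by fun_prop) (by fun_prop),
    Measure.restrict_univ]
  refine lintegral_congr fun s => ?_
  simp only [Pi.mul_apply]
  rw [← mul_assoc, ← ENNReal.ofReal_mul (abs_nonneg _), abs_of_pos (Real.exp_pos _),
    ← pow_succ', Nat.sub_add_cancel hn, ← Real.exp_nat_mul]

/-- Log-polar coordinates `x = e ^ s • θ`. -/
theorem measurePreserving_exp_smul_sphere [Nontrivial E] (μ : Measure E) [μ.IsAddHaarMeasure] :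
    MeasurePreserving (fun p : ℝ × sphere (0 : E) 1 => Real.exp p.1 • (p.2 : E))
      ((logRadialMeasure E).prod μ.toSphere) μ := by
  have hm : Measurable fun p : ℝ × sphere (0 : E) 1 => Real.exp p.1 • (p.2 : E) := by fun_prop
  refine ⟨hm, (Measure.ext_of_lintegral _ fun F hF => ?_)⟩
  rw [lintegral_map hF hm, lintegral_eq_lintegral_exp_smul_sphere μ hF]

theorem lintegral_comp_log_norm [Nontrivial E] (μ : Measure E) [μ.IsAddHaarMeasure]
    {F : ℝ → ℝ≥0∞} (hF : Measurable F) :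
    ∫⁻ x, F (Real.log ‖x‖) ∂μ = μ.toSphere univ *
      ∫⁻ s, ENNReal.ofReal (Real.exp (Module.finrank ℝ E * s)) * F s := by
  rw [lintegral_eq_lintegral_exp_smul_sphere μ (F := fun x => F (Real.log ‖x‖)) (by fun_prop)]
  simp only [norm_exp_smul_sphere, Real.log_exp]
  rw [lintegral_prod _ (by fun_prop)]
  simp only [lintegral_const]
  rw [lintegral_mul_const _ hF, mul_comm, logRadialMeasure,
    lintegral_withDensity_eq_lintegral_mul _ (by fun_prop) hF]
  rfl

theorem ae_comp_log_norm [Nontrivial E] (μ : Measure E) [μ.IsAddHaarMeasure] {p : ℝ → Prop}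
    (hp : ∀ᵐ s, p s) : ∀ᵐ x ∂μ, p (Real.log ‖x‖) := by
  obtain ⟨t, ht, htm, ht0⟩ := exists_measurable_superset_of_null (ae_iff.1 hp)
  have hF : Measurable (t.indicator (1 : ℝ → ℝ≥0∞)) := measurable_one.indicator htm
  have h0 : ∫⁻ x, t.indicator 1 (Real.log ‖x‖) ∂μ = 0 := by
    rw [lintegral_comp_log_norm μ hF, (lintegral_eq_zero_iff (by fun_prop)).2, mul_zero]
    filter_upwards [measure_eq_zero_iff_ae_notMem.1 ht0] with s hs
    simp [hs]
  have h1 := (lintegral_eq_zero_iff (f := fun x : E => t.indicator (1 : ℝ → ℝ≥0∞) (Real.log ‖x‖))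
    (by fun_prop)).1 h0
  filter_upwards [h1] with x hx
  by_contra hcon
  have := ht (show Real.log ‖x‖ ∈ {a | ¬ p a} from hcon)
  simp [this] at hx

end LogPolar

/-! ### Maximal functions in the logarithmic coordinate -/

section LogMaximal

variable {E : Type*} [NormedAddCommGroup E]

variable (E) in
/-- The normalised centre and radius `(ζ, ρ)` of a ball whose closure meets the unit sphere and
whose radius lies between `ε` and `1 / 4`. -/
def admissibleBalls (ε : ℝ) : Set (E × ℝ) :=
  {κ | |‖κ.1‖ - 1| ≤ κ.2 ∧ ε ≤ κ.2 ∧ κ.2 ≤ 1 / 4}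

theorem admissibleBalls_anti {ε ε' : ℝ} (h : ε ≤ ε') :
    admissibleBalls E ε' ⊆ admissibleBalls E ε :=
  fun _ hκ => ⟨hκ.1, h.trans hκ.2.1, hκ.2.2⟩

theorem nonneg_of_mem_admissibleBalls {ε : ℝ} {κ : E × ℝ} (hκ : κ ∈ admissibleBalls E ε) :
    0 ≤ κ.2 := (abs_nonneg _).trans hκ.1

variable [NormedSpace ℝ E]

/-- `log ‖ζ + ρ y‖` for a pair `κ = (ζ, ρ)`. The norm is truncated below at `1 / 2` in order to be
continuous everywhere; the truncation is void for the pairs and points that are used. -/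
noncomputable def logShift (κ : E × ℝ) (y : E) : ℝ :=
  Real.log (max ‖κ.1 + κ.2 • y‖ (1 / 2))

theorem continuous_logShift : Continuous fun p : (E × ℝ) × E => logShift p.1 p.2 := by
  unfold logShift
  refine Continuous.log (by fun_prop) fun p => ?_
  have : (0 : ℝ) < max ‖p.1.1 + p.1.2 • p.2‖ (1 / 2) := lt_max_of_lt_right (by norm_num)
  exact this.ne'

theorem abs_norm_add_smul_sub_one_le {ε : ℝ} {κ : E × ℝ} (hκ : κ ∈ admissibleBalls E ε) {y : E}
    (hy : y ∈ closedBall (0 : E) 1) :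
    |‖κ.1 + κ.2 • y‖ - 1| ≤ 2 * κ.2 ∧ |‖κ.1 + κ.2 • y‖ - ‖κ.1‖| ≤ κ.2 := by
  have h0 := nonneg_of_mem_admissibleBalls hκ
  have h1 : |‖κ.1 + κ.2 • y‖ - ‖κ.1‖| ≤ κ.2 := by
    refine (abs_norm_sub_norm_le _ _).trans ?_
    rw [add_sub_cancel_left, norm_smul, Real.norm_eq_abs, abs_of_nonneg h0]
    exact mul_le_of_le_one_right h0 (by simpa using hy)
  refine ⟨?_, h1⟩
  have := abs_add_le (‖κ.1 + κ.2 • y‖ - ‖κ.1‖) (‖κ.1‖ - 1)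
  rw [sub_add_sub_cancel] at this
  linarith [hκ.1]

theorem half_le_norm_add_smul {ε : ℝ} {κ : E × ℝ} (hκ : κ ∈ admissibleBalls E ε) {y : E}
    (hy : y ∈ closedBall (0 : E) 1) : 1 / 2 ≤ ‖κ.1 + κ.2 • y‖ := by
  have h1 := (abs_le.1 (abs_norm_add_smul_sub_one_le hκ hy).1).1
  linarith [hκ.2.2]

theorem logShift_eq {ε : ℝ} {κ : E × ℝ} (hκ : κ ∈ admissibleBalls E ε) {y : E}
    (hy : y ∈ closedBall (0 : E) 1) : logShift κ y = Real.log ‖κ.1 + κ.2 • y‖ := by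
  rw [logShift, max_eq_left (half_le_norm_add_smul hκ hy)]

theorem abs_logShift_le {ε : ℝ} {κ : E × ℝ} (hκ : κ ∈ admissibleBalls E ε) {y : E}
    (hy : y ∈ closedBall (0 : E) 1) : |logShift κ y| ≤ 4 * κ.2 := by
  rw [logShift_eq hκ hy]
  have h1 := half_le_norm_add_smul hκ hy
  have h2 := abs_le.1 (abs_norm_add_smul_sub_one_le hκ hy).1
  have h0 := nonneg_of_mem_admissibleBalls hκ
  set N := ‖κ.1 + κ.2 • y‖
  have hN : 0 < N := by linarith
  rw [abs_le]
  constructor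
  · have := Real.one_sub_inv_le_log_of_pos hN
    have h3 : N⁻¹ - 1 ≤ 4 * κ.2 := by
      rw [sub_le_iff_le_add, inv_le_iff_one_le_mul₀ hN]
      nlinarith
    linarith
  · linarith [Real.log_le_sub_one_of_pos hN]

theorem abs_logShift_le_one {ε : ℝ} {κ : E × ℝ} (hκ : κ ∈ admissibleBalls E ε) {y : E}
    (hy : y ∈ closedBall (0 : E) 1) : |logShift κ y| ≤ 1 := by
  linarith [abs_logShift_le hκ hy, hκ.2.2]

/-- The ball `e ^ s • B(ζ, ρ)`, rescaled to any radius between `e ^ s` and the norm of one of its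
points. The closure of the ball still meets the corresponding sphere, and the relative radius grows
at most by the factor `2`, since norms of points of the ball are at least `1 / 2`. -/
theorem smul_mem_admissibleBalls {κ : E × ℝ} (hκ : κ ∈ admissibleBalls E 0) (h8 : κ.2 ≤ 1 / 8)
    {y : E} (hy : y ∈ closedBall (0 : E) 1) {η : ℝ} (hη : η ∈ uIcc 0 (logShift κ y)) :
    (Real.exp (-η) • κ.1, Real.exp (-η) * κ.2) ∈ admissibleBalls E 0 := by
  have h0 := nonneg_of_mem_admissibleBalls hκ
  have hN := half_le_norm_add_smul hκ hy
  have h1 := abs_le.1 (abs_norm_add_smul_sub_one_le hκ hy).2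
  have h2 := abs_le.1 hκ.1
  rw [logShift_eq hκ hy] at hη
  set N := ‖κ.1 + κ.2 • y‖
  have hN0 : 0 < N := by linarith
  have hexp : min 1 N ≤ Real.exp η ∧ Real.exp η ≤ max 1 N := by
    rcases le_total 0 (Real.log N) with h | h
    · rw [uIcc_of_le h] at hη
      refine ⟨(min_le_left _ _).trans (Real.one_le_exp hη.1), le_max_of_le_right ?_⟩
      rw [← Real.exp_log hN0]; exact Real.exp_le_exp.2 hη.2
    · rw [uIcc_of_ge h] at hη
      refine ⟨min_le_of_right_le ?_, le_max_of_le_left (Real.exp_le_one_iff.2 hη.2)⟩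
      rw [← Real.exp_log hN0]; exact Real.exp_le_exp.2 hη.1
  have he := Real.exp_pos η
  have hhalf : 1 / 2 ≤ Real.exp η := (le_min (by norm_num) hN).trans hexp.1
  have hle : ‖κ.1‖ - κ.2 ≤ Real.exp η := (le_min (by linarith) (by linarith)).trans hexp.1
  have hge : Real.exp η ≤ ‖κ.1‖ + κ.2 := hexp.2.trans (max_le (by linarith) (by linarith))
  rw [Real.exp_neg]
  refine ⟨?_, by positivity, ?_⟩
  · simp only [norm_smul, norm_inv, Real.norm_eq_abs, abs_of_pos he]
    have : (Real.exp η)⁻¹ * ‖κ.1‖ - 1 = (Real.exp η)⁻¹ * (‖κ.1‖ - Real.exp η) := by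
      field_simp
    rw [this, abs_mul, abs_of_pos (inv_pos.2 he)]
    refine mul_le_mul_of_nonneg_left (abs_le.2 ⟨by linarith, by linarith⟩) (inv_pos.2 he).le
  · rw [inv_mul_le_iff₀ he]
    linarith

theorem logShift_smul {κ : E × ℝ} (hκ : κ ∈ admissibleBalls E 0) {η : ℝ}
    (hκ' : (Real.exp (-η) • κ.1, Real.exp (-η) * κ.2) ∈ admissibleBalls E 0)
    {y : E} (hy : y ∈ closedBall (0 : E) 1) :
    η + logShift (Real.exp (-η) • κ.1, Real.exp (-η) * κ.2) y = logShift κ y := by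
  have hN := half_le_norm_add_smul hκ hy
  rw [logShift_eq hκ hy, logShift_eq hκ' hy]
  simp only
  rw [mul_smul, ← smul_add, norm_smul, Real.norm_eq_abs, abs_of_pos (Real.exp_pos _),
    Real.log_mul (Real.exp_pos _).ne' (by positivity), Real.log_exp]
  ring

theorem isCompact_admissibleBalls [FiniteDimensional ℝ E] (ε : ℝ) :
    IsCompact (admissibleBalls E ε) := by
  have : ProperSpace E := FiniteDimensional.proper ℝ E
  refine isCompact_of_isClosed_isBounded ?_ ?_
  · have h1 : IsClosed {κ : E × ℝ | |‖κ.1‖ - 1| ≤ κ.2} := isClosed_le (by fun_prop) (by fun_prop)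
    have h2 : IsClosed {κ : E × ℝ | ε ≤ κ.2} := isClosed_le (by fun_prop) (by fun_prop)
    have h3 : IsClosed {κ : E × ℝ | κ.2 ≤ 1 / 4} := isClosed_le (by fun_prop) (by fun_prop)
    exact h1.inter (h2.inter h3)
  · refine (isBounded_closedBall (x := (0 : E × ℝ)) (r := 2)).subset fun κ hκ => ?_
    have h0 := nonneg_of_mem_admissibleBalls hκ
    have h1 := (abs_le.1 hκ.1).2
    have h2 := hκ.2.2
    rw [mem_closedBall_zero_iff, Prod.norm_def, max_le_iff, Real.norm_eq_abs, abs_of_nonneg h0]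
    constructor <;> linarith

theorem admissibleBalls_nonempty [Nontrivial E] {ε : ℝ} (hε : ε ≤ 1 / 4) :
    (admissibleBalls E ε).Nonempty := by
  obtain ⟨e, he⟩ := exists_norm_eq E (zero_le_one' ℝ)
  exact ⟨(e, 1 / 4), by simp [he], hε, le_rfl⟩

variable [MeasurableSpace E]

/-- For a radial function `x ↦ Γ (log ‖x‖)`, its average over the ball `e ^ s • B(ζ, ρ)`. -/
noncomputable def logAverage (μ : Measure E) (Γ : ℝ → ℝ) (s : ℝ) (κ : E × ℝ) : ℝ :=
  ⨍ y in closedBall (0 : E) 1, Γ (s + logShift κ y) ∂μ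

/-- For a radial function `x ↦ Γ (log ‖x‖)`, its maximal function at the points of norm `e ^ s`,
over balls of relative radius between `ε` and `1 / 4`. -/
noncomputable def logMaximal (μ : Measure E) (Γ : ℝ → ℝ) (ε s : ℝ) : ℝ :=
  sSup (logAverage μ Γ s '' admissibleBalls E ε)

end LogMaximal

theorem measureReal_closedBall_pos {E : Type*} [NormedAddCommGroup E] [NormedSpace ℝ E]
    [MeasurableSpace E] [FiniteDimensional ℝ E] {μ : Measure E} [μ.IsAddHaarMeasure] :
    0 < μ.real (closedBall (0 : E) 1) := by
  have : ProperSpace E := FiniteDimensional.proper ℝ E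
  exact ENNReal.toReal_pos (measure_closedBall_pos μ 0 one_pos).ne'
    measure_closedBall_lt_top.ne

section LogMaximal

variable {E : Type*} [NormedAddCommGroup E] [NormedSpace ℝ E] [MeasurableSpace E] [BorelSpace E]
  {μ : Measure E} {Γ : ℝ → ℝ}

/-- The same ball, described relative to the radius `e ^ (s + η)` instead of `e ^ s`. -/
theorem logAverage_smul {κ : E × ℝ} (hκ : κ ∈ admissibleBalls E 0) {s η : ℝ}
    (hκ' : (Real.exp (-η) • κ.1, Real.exp (-η) * κ.2) ∈ admissibleBalls E 0) :
    logAverage μ Γ (s + η) (Real.exp (-η) • κ.1, Real.exp (-η) * κ.2) = logAverage μ Γ s κ := by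
  simp only [logAverage, setAverage_eq]
  congr 1
  refine setIntegral_congr_fun measurableSet_closedBall fun y hy => ?_
  rw [← logShift_smul hκ hκ' hy, add_assoc]

variable [FiniteDimensional ℝ E] [μ.IsAddHaarMeasure]

theorem continuous_logAverage (hΓ : Continuous Γ) :
    Continuous fun p : ℝ × (E × ℝ) => logAverage μ Γ p.1 p.2 := by
  have : ProperSpace E := FiniteDimensional.proper ℝ E
  simp only [logAverage, setAverage_eq, smul_eq_mul]
  refine continuous_const.mul ?_
  refine continuous_parametric_integral_of_continuous
    (f := fun (p : ℝ × (E × ℝ)) (y : E) => Γ (p.1 + logShift p.2 y)) ?_ (isCompact_closedBall 0 1)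
  exact hΓ.comp ((by fun_prop : Continuous fun q : (ℝ × (E × ℝ)) × E => q.1.1).add
    (continuous_logShift.comp
      (by fun_prop : Continuous fun q : (ℝ × (E × ℝ)) × E => (q.1.2, q.2))))

theorem integrableOn_comp_logShift (hΓ : Continuous Γ) (s : ℝ) (κ : E × ℝ) :
    IntegrableOn (fun y => Γ (s + logShift κ y)) (closedBall (0 : E) 1) μ := by
  have : ProperSpace E := FiniteDimensional.proper ℝ E
  refine Continuous.continuousOn ?_ |>.integrableOn_compact (isCompact_closedBall 0 1)
  exact hΓ.comp (continuous_const.add (continuous_logShift.comp (by fun_prop :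
    Continuous fun y : E => (κ, y))))

theorem continuous_logMaximal (hΓ : Continuous Γ) (ε : ℝ) : Continuous (logMaximal μ Γ ε) :=
  (isCompact_admissibleBalls (E := E) ε).continuous_sSup (continuous_logAverage (μ := μ) hΓ)

theorem logAverage_le_logMaximal (hΓ : Continuous Γ) {ε s : ℝ} {κ : E × ℝ}
    (hκ : κ ∈ admissibleBalls E ε) : logAverage μ Γ s κ ≤ logMaximal μ Γ ε s :=
  le_csSup ((isCompact_admissibleBalls ε).bddAbove_image
    ((continuous_logAverage (μ := μ) hΓ).comp (by fun_prop :
      Continuous fun κ : E × ℝ => (s, κ))).continuousOn) (mem_image_of_mem _ hκ)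

theorem exists_logMaximal_eq [Nontrivial E] (hΓ : Continuous Γ) {ε : ℝ} (hε : ε ≤ 1 / 4) (s : ℝ) :
    ∃ κ ∈ admissibleBalls E ε, logMaximal μ Γ ε s = logAverage μ Γ s κ :=
  (isCompact_admissibleBalls ε).exists_sSup_image_eq (admissibleBalls_nonempty hε)
    ((continuous_logAverage (μ := μ) hΓ).comp (by fun_prop :
      Continuous fun κ : E × ℝ => (s, κ))).continuousOn

theorem logMaximal_anti [Nontrivial E] (hΓ : Continuous Γ) {ε ε' : ℝ} (h : ε ≤ ε')
    (hε : ε' ≤ 1 / 4) (s : ℝ) : logMaximal μ Γ ε' s ≤ logMaximal μ Γ ε s := by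
  obtain ⟨κ, hκ, he⟩ := exists_logMaximal_eq (μ := μ) hΓ hε s
  rw [he]
  exact logAverage_le_logMaximal hΓ (admissibleBalls_anti h hκ)

/-- The pair `(ζ, 0)` with `‖ζ‖ = 1` is admissible, and its average is the value of the function. -/
theorem le_logMaximal [Nontrivial E] (hΓ : Continuous Γ) (s : ℝ) : Γ s ≤ logMaximal μ Γ 0 s := by
  obtain ⟨e, he⟩ := exists_norm_eq E (zero_le_one' ℝ)
  have hκ : ((e, 0) : E × ℝ) ∈ admissibleBalls E 0 := ⟨by simp [he], le_rfl, by norm_num⟩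
  refine le_trans (le_of_eq ?_) (logAverage_le_logMaximal hΓ hκ)
  have : ∀ y : E, logShift (e, (0 : ℝ)) y = 0 := fun y => by
    simp only [logShift, zero_smul, add_zero, he]
    rw [max_eq_left (by norm_num), Real.log_one]
  have h1 := measureReal_closedBall_pos (μ := μ)
  simp only [logAverage, this, add_zero, setAverage_eq, setIntegral_const, smul_smul]
  rw [inv_mul_cancel₀ h1.ne', one_smul]

theorem exists_logAverage_le (hΓ : Continuous Γ) (s : ℝ) (κ : E × ℝ) :
    ∃ y ∈ closedBall (0 : E) 1, logAverage μ Γ s κ ≤ Γ (s + logShift κ y) := by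
  have : ProperSpace E := FiniteDimensional.proper ℝ E
  exact exists_setAverage_le (measure_closedBall_pos μ 0 one_pos).ne'
    measure_closedBall_lt_top.ne (integrableOn_comp_logShift hΓ s κ)

/-- The maximal function has no strict local maximum where it is attained at a small ball: the ball
remains admissible for all radii between `e ^ s` and the norm of any point of the ball. -/
theorem logAverage_le_logMaximal_of_mem_uIcc (hΓ : Continuous Γ) {κ : E × ℝ}
    (hκ : κ ∈ admissibleBalls E 0) (h8 : κ.2 ≤ 1 / 8) {y : E} (hy : y ∈ closedBall (0 : E) 1)
    {s τ : ℝ} (hτ : τ ∈ uIcc s (s + logShift κ y)) :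
    logAverage μ Γ s κ ≤ logMaximal μ Γ 0 τ := by
  have hη : τ - s ∈ uIcc 0 (logShift κ y) := by
    rw [mem_uIcc] at hτ ⊢
    rcases hτ with h | h
    · left; constructor <;> linarith [h.1, h.2]
    · right; constructor <;> linarith [h.1, h.2]
  have hκ' := smul_mem_admissibleBalls hκ h8 hy hη
  rw [← logAverage_smul hκ hκ', add_sub_cancel]
  exact logAverage_le_logMaximal hΓ hκ'

/-- The density of `log ‖·‖` with respect to normalised Lebesgue measure on a ball of relative
radius at least `ε` is bounded. -/
theorem exists_lintegral_comp_logShift_le [Nontrivial E] (μ : Measure E) [μ.IsAddHaarMeasure]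
    {ε : ℝ} (hε : 0 < ε) :
    ∃ C : ℝ, 0 ≤ C ∧ ∀ κ ∈ admissibleBalls E ε, ∀ H : ℝ → ℝ≥0∞, Measurable H →
      ∫⁻ y in closedBall (0 : E) 1, H (logShift κ y) ∂μ ≤
        ENNReal.ofReal C * ∫⁻ t in Icc (-1) 1, H t := by
  set n := Module.finrank ℝ E
  refine ⟨(ε ^ n)⁻¹ * (μ.toSphere.real univ * Real.exp n), by positivity, fun κ hκ H hH => ?_⟩
  have hρ : 0 < κ.2 := hε.trans_le hκ.2.1
  set F : E → ℝ≥0∞ := fun z => (Icc (-1 : ℝ) 1).indicator H (Real.log ‖z‖) with hF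
  have hI : Measurable ((Icc (-1 : ℝ) 1).indicator H) := hH.indicator measurableSet_Icc
  have hFm : Measurable F := hI.comp (by fun_prop)
  calc ∫⁻ y in closedBall (0 : E) 1, H (logShift κ y) ∂μ
      = ∫⁻ y in closedBall (0 : E) 1, F (κ.1 + κ.2 • y) ∂μ := by
        refine setLIntegral_congr_fun measurableSet_closedBall fun y hy => ?_
        have h1 := abs_le.1 (abs_logShift_le_one hκ hy)
        rw [logShift_eq hκ hy] at h1 ⊢
        simp only [hF]
        rw [indicator_of_mem (mem_Icc.2 h1)]
    _ ≤ ∫⁻ y, F (κ.1 + κ.2 • y) ∂μ := setLIntegral_le_lintegral _ _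
    _ = ∫⁻ z, F (κ.1 + z) ∂(Measure.map (κ.2 • ·) μ) := by
        rw [lintegral_map (by fun_prop) (by fun_prop)]
    _ = ENNReal.ofReal ((κ.2 ^ n)⁻¹) * ∫⁻ z, F z ∂μ := by
        rw [Measure.map_addHaar_smul μ hρ.ne', lintegral_smul_measure,
          lintegral_add_left_eq_self F κ.1, abs_of_pos (by positivity)]
        rfl
    _ ≤ ENNReal.ofReal ((ε ^ n)⁻¹) * ∫⁻ z, F z ∂μ := by
        gcongr
        exact hκ.2.1
    _ ≤ ENNReal.ofReal ((ε ^ n)⁻¹) * (μ.toSphere univ *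
          (ENNReal.ofReal (Real.exp n) * ∫⁻ t in Icc (-1) 1, H t)) := by
        gcongr
        rw [hF, lintegral_comp_log_norm μ hI]
        gcongr
        rw [← lintegral_indicator measurableSet_Icc, ← lintegral_const_mul _ hI]
        refine lintegral_mono fun t => ?_
        by_cases ht : t ∈ Icc (-1 : ℝ) 1
        · gcongr
          exact mul_le_of_le_one_right (Nat.cast_nonneg _) ht.2
        · simp [ht]
    _ = ENNReal.ofReal ((ε ^ n)⁻¹ * (μ.toSphere.real univ * Real.exp n)) *
          ∫⁻ t in Icc (-1) 1, H t := by
        rw [ENNReal.ofReal_mul (by positivity), ENNReal.ofReal_mul (by positivity),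
          measureReal_def, ENNReal.ofReal_toReal (measure_ne_top _ _)]
        ring

theorem ofReal_intervalIntegral_eq_setLIntegral {g : ℝ → ℝ} {a b : ℝ} (hab : a ≤ b)
    (hg : IntegrableOn g (Icc a b) volume) (hg0 : ∀ x, 0 ≤ g x) :
    ENNReal.ofReal (∫ x in a..b, g x) = ∫⁻ x in Icc a b, ENNReal.ofReal (g x) := by
  rw [intervalIntegral.integral_of_le hab, ← integral_Icc_eq_integral_Ioc,
    ofReal_integral_eq_lintegral_ofReal hg (Eventually.of_forall hg0)]

/-- The average of an absolutely continuous `Γ` over a ball of relative radius at least `ε` is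
Lipschitz in the position of the ball: it is a convolution of `Γ` with a bounded density. -/
theorem exists_abs_logAverage_sub_le [Nontrivial E] (μ : Measure E) [μ.IsAddHaarMeasure]
    {ε : ℝ} (hε : 0 < ε) :
    ∃ C : ℝ, 0 ≤ C ∧ ∀ Γ g : ℝ → ℝ, Continuous Γ → Measurable g → LocallyIntegrable g volume →
      (∀ x, 0 ≤ g x) → (∀ p q, p ≤ q → |Γ q - Γ p| ≤ ∫ x in p..q, g x) →
      ∀ κ ∈ admissibleBalls E ε, ∀ a b p q, a ≤ p → p ≤ q → q ≤ b →
        |logAverage μ Γ q κ - logAverage μ Γ p κ| ≤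
          C * (∫ x in (a - 1)..(b + 1), g x) * (q - p) := by
  have : ProperSpace E := FiniteDimensional.proper ℝ E
  obtain ⟨C, hC0, hC⟩ := exists_lintegral_comp_logShift_le μ hε
  set B := closedBall (0 : E) 1 with hBdef
  have hB := measureReal_closedBall_pos (μ := μ)
  refine ⟨(μ.real B)⁻¹ * C, by positivity,
    fun Γ g hΓ hgm hgl hg0 hΓg κ hκ a b p q hap hpq hqb => ?_⟩
  have hgi : ∀ a b, IntegrableOn g (Icc a b) volume := fun a b =>
    hgl.integrableOn_isCompact isCompact_Icc
  set G : ℝ → ℝ≥0∞ := fun x => ENNReal.ofReal (g x) with hG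
  have hGm : Measurable G := by fun_prop
  have hint := ofReal_intervalIntegral_eq_setLIntegral (a := a - 1) (b := b + 1) (by linarith)
    (hgi _ _) hg0
  have hpt : ∀ t, ‖Γ (q + t) - Γ (p + t)‖ₑ ≤ ∫⁻ σ in Icc p q, G (σ + t) := by
    intro t
    rw [← ofReal_norm, Real.norm_eq_abs]
    refine (ENNReal.ofReal_le_ofReal (hΓg (p + t) (q + t) (by linarith))).trans ?_
    rw [ofReal_intervalIntegral_eq_setLIntegral (by linarith) (hgi _ _) hg0,
      ← lintegral_indicator measurableSet_Icc, ← lintegral_indicator measurableSet_Icc,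
      ← lintegral_add_right_eq_self _ t]
    refine lintegral_mono fun σ => le_of_eq ?_
    by_cases hσ : σ ∈ Icc p q
    · rw [indicator_of_mem hσ, indicator_of_mem]
      exact ⟨by linarith [hσ.1], by linarith [hσ.2]⟩
    · rw [indicator_of_notMem hσ, indicator_of_notMem]
      exact fun h => hσ ⟨by linarith [h.1], by linarith [h.2]⟩
  have hlsm : Measurable fun y : E => logShift κ y :=
    (continuous_logShift.comp (by fun_prop : Continuous fun y : E => (κ, y))).measurable
  have hmain : ‖∫ y in B, (Γ (q + logShift κ y) - Γ (p + logShift κ y)) ∂μ‖ₑ ≤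
      ENNReal.ofReal (C * (∫ x in (a - 1)..(b + 1), g x) * (q - p)) := by
    calc ‖∫ y in B, (Γ (q + logShift κ y) - Γ (p + logShift κ y)) ∂μ‖ₑ
        ≤ ∫⁻ y in B, ‖Γ (q + logShift κ y) - Γ (p + logShift κ y)‖ₑ ∂μ :=
          enorm_integral_le_lintegral_enorm _
      _ ≤ ∫⁻ y in B, (∫⁻ σ in Icc p q, G (σ + logShift κ y)) ∂μ :=
          lintegral_mono fun y => hpt _
      _ = ∫⁻ σ in Icc p q, ∫⁻ y in B, G (σ + logShift κ y) ∂μ := by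
          rw [lintegral_lintegral_swap]
          exact (hGm.comp (by fun_prop)).aemeasurable
      _ ≤ ∫⁻ σ in Icc p q, ENNReal.ofReal C * ∫⁻ t in Icc (a - 1) (b + 1), G t := by
          refine setLIntegral_mono measurable_const fun σ hσ => ?_
          refine (hC κ hκ (fun t => G (σ + t)) (by fun_prop)).trans (mul_le_mul' le_rfl ?_)
          rw [← lintegral_indicator measurableSet_Icc, ← lintegral_indicator measurableSet_Icc,
            ← lintegral_add_left_eq_self ((Icc (a - 1) (b + 1)).indicator G) σ]
          refine lintegral_mono fun t => ?_
          by_cases ht : t ∈ Icc (-1 : ℝ) 1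
          · rw [indicator_of_mem ht, indicator_of_mem]
            exact ⟨by linarith [hσ.1, ht.1], by linarith [hσ.2, ht.2]⟩
          · rw [indicator_of_notMem ht]; exact zero_le
      _ = ENNReal.ofReal (C * (∫ x in (a - 1)..(b + 1), g x) * (q - p)) := by
          rw [setLIntegral_const, Real.volume_Icc, ← hint, ← ENNReal.ofReal_mul hC0,
            ← ENNReal.ofReal_mul]
          exact mul_nonneg hC0 (intervalIntegral.integral_nonneg (by linarith) fun x _ => hg0 x)
  have hnn : 0 ≤ C * (∫ x in (a - 1)..(b + 1), g x) * (q - p) :=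
    mul_nonneg (mul_nonneg hC0 (intervalIntegral.integral_nonneg (by linarith) fun x _ => hg0 x))
      (by linarith)
  rw [← ofReal_norm, ENNReal.ofReal_le_ofReal_iff hnn, Real.norm_eq_abs,
    integral_sub (integrableOn_comp_logShift hΓ q κ) (integrableOn_comp_logShift hΓ p κ)] at hmain
  simp only [logAverage, setAverage_eq, smul_eq_mul]
  rw [← mul_sub, abs_mul, abs_of_pos (inv_pos.2 hB), mul_assoc, mul_assoc, ← mul_assoc C]
  exact mul_le_mul_of_nonneg_left hmain (inv_pos.2 hB).le

/-- Large balls contribute a Lipschitz function to the maximal function. -/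
theorem exists_abs_logMaximal_sub_le [Nontrivial E] (μ : Measure E) [μ.IsAddHaarMeasure]
    {ε : ℝ} (hε : 0 < ε) (hε' : ε ≤ 1 / 4) :
    ∃ C : ℝ, 0 ≤ C ∧ ∀ Γ g : ℝ → ℝ, Continuous Γ → Measurable g → LocallyIntegrable g volume →
      (∀ x, 0 ≤ g x) → (∀ p q, p ≤ q → |Γ q - Γ p| ≤ ∫ x in p..q, g x) →
      ∀ a b p q, a ≤ p → p ≤ q → q ≤ b →
        |logMaximal μ Γ ε q - logMaximal μ Γ ε p| ≤
          C * (∫ x in (a - 1)..(b + 1), g x) * (q - p) := by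
  obtain ⟨C, hC0, hC⟩ := exists_abs_logAverage_sub_le μ hε
  refine ⟨C, hC0, fun Γ g hΓ hgm hgl hg0 hΓg a b p q hap hpq hqb => ?_⟩
  obtain ⟨κ, hκ, h1⟩ := exists_logMaximal_eq (μ := μ) hΓ hε' p
  obtain ⟨κ', hκ', h2⟩ := exists_logMaximal_eq (μ := μ) hΓ hε' q
  have h3 := abs_le.1 (hC Γ g hΓ hgm hgl hg0 hΓg κ hκ a b p q hap hpq hqb)
  have h4 := abs_le.1 (hC Γ g hΓ hgm hgl hg0 hΓg κ' hκ' a b p q hap hpq hqb)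
  have h5 := logAverage_le_logMaximal (μ := μ) (s := q) hΓ hκ
  have h6 := logAverage_le_logMaximal (μ := μ) (s := p) hΓ hκ'
  rw [abs_le]
  constructor <;> linarith

end LogMaximal

/-! ### Absolute continuity of the maximal function -/

section LogMaximal

variable {E : Type*} [NormedAddCommGroup E] [NormedSpace ℝ E] [MeasurableSpace E] [BorelSpace E]
  [FiniteDimensional ℝ E] [Nontrivial E] {μ : Measure E} [μ.IsAddHaarMeasure] {Γ g : ℝ → ℝ}

/-- Small balls have averages close to the value of the function, so that they do not matter where
the maximal function exceeds `Γ` by a fixed amount. -/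
theorem exists_max_logMaximal_eq (hΓ : Continuous Γ) (a b : ℝ) {δ : ℝ} (hδ : 0 < δ) :
    ∃ ε, 0 < ε ∧ ε ≤ 1 / 4 ∧ ∀ s ∈ Icc a b,
      max (logMaximal μ Γ 0 s) (Γ s + δ) = max (logMaximal μ Γ ε s) (Γ s + δ) := by
  have huc := (isCompact_Icc (a := a - 1) (b := b + 1)).uniformContinuousOn_of_continuous
    hΓ.continuousOn
  obtain ⟨η, hη, hu⟩ := Metric.uniformContinuousOn_iff.1 huc δ hδ
  refine ⟨min (1 / 4) (η / 4), by positivity, min_le_left _ _, fun s hs => ?_⟩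
  set ε := min (1 / 4) (η / 4)
  have hε0 : 0 ≤ ε := by positivity
  refine le_antisymm (max_le ?_ (le_max_right _ _)) (max_le_max_right _
    (logMaximal_anti hΓ hε0 (min_le_left _ _) s))
  obtain ⟨κ, hκ, he⟩ := exists_logMaximal_eq (μ := μ) hΓ (by norm_num : (0 : ℝ) ≤ 1 / 4) s
  rcases le_or_gt ε κ.2 with h | h
  · exact le_max_of_le_left (he ▸ logAverage_le_logMaximal hΓ ⟨hκ.1, h, hκ.2.2⟩)
  · obtain ⟨y, hy, hle⟩ := exists_logAverage_le (μ := μ) hΓ s κ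
    have h1 := abs_logShift_le hκ hy
    have h2 := abs_le.1 (abs_logShift_le_one hκ hy)
    have h3 : ε ≤ η / 4 := min_le_right _ _
    have h4 := hu (s + logShift κ y) ⟨by linarith [hs.1], by linarith [hs.2]⟩ s
      ⟨by linarith [hs.1], by linarith [hs.2]⟩ (by
        rw [Real.dist_eq, add_sub_cancel_left]; linarith)
    rw [Real.dist_eq] at h4
    refine le_max_of_le_right ?_
    rw [he]
    linarith [(abs_lt.1 h4).2]

theorem abs_max_sub_max_le_add {x y x' y' A B : ℝ} (h1 : |x - x'| ≤ A) (h2 : |y - y'| ≤ B) :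
    |max x y - max x' y'| ≤ A + B := by
  have := abs_max_sub_max_le_max x y x' y'
  refine this.trans (max_le ?_ ?_)
  · linarith [(abs_nonneg _).trans h2]
  · linarith [(abs_nonneg _).trans h1]

/-- The maximal function, truncated below slightly above `Γ`. Only balls of radius bounded below
matter for it, whence its absolute continuity. -/
theorem absolutelyContinuousOnInterval_max_logMaximal (hΓ : Continuous Γ) (hgm : Measurable g)
    (hgl : LocallyIntegrable g volume) (hg0 : ∀ x, 0 ≤ g x)
    (hΓg : ∀ p q, p ≤ q → |Γ q - Γ p| ≤ ∫ x in p..q, g x) {a b : ℝ} (hab : a ≤ b) {δ : ℝ}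
    (hδ : 0 < δ) :
    AbsolutelyContinuousOnInterval (fun s => max (logMaximal μ Γ 0 s) (Γ s + δ)) a b := by
  obtain ⟨ε, hε, hε4, hM⟩ := exists_max_logMaximal_eq (μ := μ) hΓ a b hδ
  obtain ⟨C, hC0, hC⟩ := exists_abs_logMaximal_sub_le μ hε hε4
  have hgi : ∀ a b, IntervalIntegrable g volume a b := fun a b =>
    (hgl.integrableOn_isCompact isCompact_uIcc).intervalIntegrable
  set L := C * (∫ x in (a - 1)..(b + 1), g x)
  refine absolutelyContinuousOnInterval_of_abs_sub_le (k := fun x => L + g x) hab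
    (intervalIntegrable_const.add (hgi _ _)) fun p hp q hq hpq => ?_
  rw [hM p hp, hM q hq, intervalIntegral.integral_add intervalIntegrable_const (hgi _ _),
    intervalIntegral.integral_const, smul_eq_mul, mul_comm]
  refine abs_max_sub_max_le_add (hC Γ g hΓ hgm hgl hg0 hΓg a b p q hp.1 hpq hq.2) ?_
  rw [add_sub_add_right_eq_sub]
  exact hΓg p q hpq

variable (μ) in
/-- The variation of the truncated maximal function, with a bound that does not depend on the
truncation. It is compared with the truncated maximal function over balls of relative radius at
least `1 / 8`: where the two differ, the optimal ball is small and contains points at which `Γ` is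
at least its average, and the maximal function is at least as large on the way to them. -/
theorem exists_eVariationOn_max_logMaximal_le :
    ∃ C : ℝ, 0 ≤ C ∧ ∀ Γ g : ℝ → ℝ, Continuous Γ → Measurable g → LocallyIntegrable g volume →
      (∀ x, 0 ≤ g x) → (∀ p q, p ≤ q → |Γ q - Γ p| ≤ ∫ x in p..q, g x) →
      ∀ δ > 0, ∀ a : ℝ,
        eVariationOn (fun s => max (logMaximal μ Γ 0 s) (Γ s + δ)) (Icc a (a + 1)) ≤
          ENNReal.ofReal (C * ∫ x in (a - 2)..(a + 3), g x) := by
  obtain ⟨C, hC0, hC⟩ := exists_abs_logMaximal_sub_le μ (by norm_num : (0 : ℝ) < 1 / 8)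
    (by norm_num)
  -- `V` below grows by the integral of `g` plus `C * I` times the length `3` of `[a - 1, a + 2]`.
  refine ⟨1 + 3 * C, by positivity, fun Γ g hΓ hgm hgl hg0 hΓg δ hδ a => ?_⟩
  have hgi : ∀ a b, IntervalIntegrable g volume a b := fun a b =>
    (hgl.integrableOn_isCompact isCompact_uIcc).intervalIntegrable
  set I := ∫ x in (a - 2)..(a + 3), g x with hI
  set V : ℝ → ℝ := fun s => C * I * s + ∫ x in (0 : ℝ)..s, g x with hV
  have hVsub : ∀ p q, V q - V p = C * I * (q - p) + ∫ x in p..q, g x := fun p q => by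
    rw [← intervalIntegral.integral_interval_sub_left (hgi 0 q) (hgi 0 p)]
    simp only [hV]; ring
  refine (eVariationOn_le_of_forall_exists_majorant (c := a - 1) (d := a + 2) (V := V)
    (h := fun s => max (logMaximal μ Γ (1 / 8) s) (Γ s + δ)) (by linarith) (by linarith)
    (fun s _ => max_le_max_right _ (logMaximal_anti hΓ (by norm_num) (by norm_num) s))
    (fun p hp q hq hpq => ?_) fun s hs => ?_).trans (ENNReal.ofReal_le_ofReal ?_)
  · rw [hVsub]
    refine abs_max_sub_max_le_add ?_ ?_
    · have := hC Γ g hΓ hgm hgl hg0 hΓg (a - 1) (a + 2) p q hp.1 hpq hq.2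
      rwa [show a - 1 - 1 = a - 2 by ring, show a + 2 + 1 = a + 3 by ring] at this
    · rw [add_sub_add_right_eq_sub]
      exact hΓg p q hpq
  · have hs' : s ∈ Icc (a - 1) (a + 2) := ⟨by linarith [hs.1], by linarith [hs.2]⟩
    have hself : ∀ τ ∈ Icc a (a + 1), τ ∈ uIcc s s →
        max (logMaximal μ Γ 0 s) (Γ s + δ) ≤ max (logMaximal μ Γ 0 τ) (Γ τ + δ) := by
      intro τ _ hτ
      rw [uIcc_self, mem_singleton_iff] at hτ
      rw [hτ]
    rcases le_or_gt (logMaximal μ Γ 0 s) (Γ s + δ) with hle | hgt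
    · refine ⟨s, hs', ?_, hself⟩
      exact max_le (le_max_of_le_right hle) (le_max_right _ _)
    obtain ⟨κ, hκ, he⟩ := exists_logMaximal_eq (μ := μ) hΓ (by norm_num : (0 : ℝ) ≤ 1 / 4) s
    rcases le_or_gt (1 / 8) κ.2 with h8 | h8
    · refine ⟨s, hs', max_le_max_right _ ?_, hself⟩
      rw [he]
      exact logAverage_le_logMaximal hΓ ⟨hκ.1, h8, hκ.2.2⟩
    · obtain ⟨y, hy, hle⟩ := exists_logAverage_le (μ := μ) hΓ s κ
      have h2 := abs_le.1 (abs_logShift_le_one hκ hy)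
      rw [max_eq_left hgt.le, he]
      refine ⟨s + logShift κ y, ⟨by linarith [hs.1], by linarith [hs.2]⟩,
        le_max_of_le_right (by linarith), fun τ _ hτ => le_max_of_le_left ?_⟩
      exact logAverage_le_logMaximal_of_mem_uIcc hΓ hκ h8.le hy hτ
  · rw [hVsub, add_mul, one_mul]
    have : ∫ x in (a - 1)..(a + 2), g x ≤ I :=
      intervalIntegral.integral_mono_interval (by linarith) (by linarith) (by linarith)
        (Eventually.of_forall hg0) (hgi _ _)
    linarith

variable (μ) in
/-- The maximal function is absolutely continuous, and the integral of its derivative over unit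
intervals is bounded by that of a density `g` of `Γ` over slightly larger intervals. The derivative
is obtained in the limit of the truncations `max (logMaximal μ Γ 0) (Γ + δ)`, `δ → 0`. -/
theorem exists_logMaximal_sub_eq_integral :
    ∃ C : ℝ, 0 ≤ C ∧ ∀ Γ g : ℝ → ℝ, Continuous Γ → Measurable g → LocallyIntegrable g volume →
      (∀ x, 0 ≤ g x) → (∀ p q, p ≤ q → |Γ q - Γ p| ≤ ∫ x in p..q, g x) →
      ∃ u : ℝ → ℝ, Measurable u ∧ LocallyIntegrable u volume ∧
        (∀ p q, logMaximal μ Γ 0 q - logMaximal μ Γ 0 p = ∫ x in p..q, u x) ∧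
        ∀ a, ∫⁻ x in Icc a (a + 1), ‖u x‖ₑ ≤ ENNReal.ofReal (C * ∫ x in (a - 2)..(a + 3), g x) := by
  obtain ⟨C, hC0, hC⟩ := exists_eVariationOn_max_logMaximal_le μ
  refine ⟨C, hC0, fun Γ g hΓ hgm hgl hg0 hΓg => ?_⟩
  have hgi : ∀ a b, IntervalIntegrable g volume a b := fun a b =>
    (hgl.integrableOn_isCompact isCompact_uIcc).intervalIntegrable
  set w := logMaximal μ Γ 0 with hw
  have hwc : Continuous w := continuous_logMaximal hΓ 0
  set δ : ℕ → ℝ := fun j => 1 / (j + 1) with hδdef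
  have hδ : ∀ j, 0 < δ j := fun j => Nat.one_div_pos_of_nat
  have hδ0 : Tendsto δ atTop (𝓝 0) := tendsto_one_div_add_atTop_nhds_zero_nat
  set M : ℕ → ℝ → ℝ := fun j s => max (w s) (Γ s + δ j) with hMdef
  have hMac : ∀ j a b, a ≤ b → AbsolutelyContinuousOnInterval (M j) a b := fun j a b hab =>
    absolutelyContinuousOnInterval_max_logMaximal hΓ hgm hgl hg0 hΓg hab (hδ j)
  have hΓac : ∀ a b, a ≤ b → AbsolutelyContinuousOnInterval Γ a b := fun a b hab =>
    absolutelyContinuousOnInterval_of_abs_sub_le hab (hgi a b) fun p _ q _ hpq => hΓg p q hpq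
  have hdiff : ∀ f : ℝ → ℝ, (∀ a b, a ≤ b → AbsolutelyContinuousOnInterval f a b) →
      ∀ᵐ t, DifferentiableAt ℝ f t := by
    intro f hf
    have : ∀ᵐ t, ∀ k : ℕ, t ∈ uIcc (-(k : ℝ)) k → DifferentiableAt ℝ f t :=
      ae_all_iff.2 fun k => (hf _ _ (by linarith [k.cast_nonneg (α := ℝ)])).ae_differentiableAt
    filter_upwards [this] with t ht
    obtain ⟨k, hk⟩ := exists_nat_ge |t|
    refine ht k ?_
    rw [uIcc_of_le (by linarith [k.cast_nonneg (α := ℝ)])]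
    exact abs_le.1 hk
  have hMd : ∀ᵐ t, ∀ j, DifferentiableAt ℝ (M j) t := ae_all_iff.2 fun j => hdiff _ (hMac j)
  have hΓd : ∀ᵐ t, DifferentiableAt ℝ Γ t := hdiff _ hΓac
  have hS : MeasurableSet {t | Γ t < w t} := (isOpen_lt hΓ hwc).measurableSet
  set u : ℝ → ℝ := fun t => open Classical in if Γ t < w t then deriv w t else deriv Γ t with hu
  have hum : Measurable u := Measurable.ite hS (measurable_deriv w) (measurable_deriv Γ)
  -- On `{w > Γ + δ}` the truncated function is locally `w`; elsewhere it touches its lower barrier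
  -- `Γ + δ`, so that the two derivatives agree.
  have hA : ∀ j t, Γ t + δ j < w t → deriv (M j) t = u t := by
    intro j t ht
    have h1 : M j =ᶠ[𝓝 t] w := by
      have : ∀ᶠ x in 𝓝 t, Γ x + δ j < w x :=
        (hΓ.add continuous_const).continuousAt.eventually_lt hwc.continuousAt ht
      filter_upwards [this] with x hx using max_eq_left hx.le
    rw [h1.deriv_eq, hu]
    simp only
    rw [if_pos (by linarith [hδ j])]
  have hB : ∀ j t, DifferentiableAt ℝ (M j) t → DifferentiableAt ℝ Γ t → w t ≤ Γ t + δ j →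
      deriv (M j) t = deriv Γ t := by
    intro j t h1 h2 ht
    have hmin : IsLocalMin (fun x => M j x - Γ x) t := by
      refine Eventually.of_forall fun x => ?_
      simp only [hMdef]
      rw [max_eq_right ht]
      linarith [le_max_right (w x) (Γ x + δ j)]
    have := hmin.deriv_eq_zero
    rw [deriv_fun_sub h1 h2] at this
    linarith
  have hbound : ∀ᵐ t, ∀ j, ‖deriv (M j) t‖ ≤ ‖u t‖ + ‖deriv Γ t‖ := by
    filter_upwards [hMd, hΓd] with t h1 h2 j
    rcases le_or_gt (w t) (Γ t + δ j) with h | h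
    · rw [hB j t (h1 j) h2 h]; linarith [norm_nonneg (u t)]
    · rw [hA j t h]; linarith [norm_nonneg (deriv Γ t)]
  have hlim : ∀ᵐ t, Tendsto (fun j => deriv (M j) t) atTop (𝓝 (u t)) := by
    filter_upwards [hMd, hΓd] with t h1 h2
    by_cases h : Γ t < w t
    · have : ∀ᶠ j in atTop, δ j < w t - Γ t := hδ0.eventually_lt_const (by linarith)
      refine tendsto_const_nhds.congr' ?_
      filter_upwards [this] with j hj
      exact (hA j t (by linarith)).symm
    · have : u t = deriv Γ t := by simp only [hu]; rw [if_neg h]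
      rw [this]
      refine tendsto_const_nhds.congr fun j => ?_
      exact (hB j t (h1 j) h2 (by linarith [hδ j])).symm
  -- The variation bound does not depend on the truncation and passes to the limit by Fatou.
  have hunit : ∀ a, ∫⁻ x in Icc a (a + 1), ‖u x‖ₑ ≤
      ENNReal.ofReal (C * ∫ x in (a - 2)..(a + 3), g x) := by
    intro a
    refine (lintegral_enorm_le_liminf_of_tendsto (ae_restrict_of_ae hlim)
      (fun j => (measurable_deriv (M j)).enorm.aemeasurable)).trans ?_
    refine liminf_le_of_le (by isBoundedDefault) fun b hb => ?_
    obtain ⟨j, hj⟩ := hb.exists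
    refine hj.trans ?_
    have hbv : BoundedVariationOn (M j) (Icc a (a + 1)) := by
      have := (hMac j a (a + 1) (by linarith)).boundedVariationOn
      rwa [uIcc_of_le (by linarith)] at this
    exact (lintegral_enorm_deriv_le_eVariationOn (by linarith) hbv).trans
      (hC Γ g hΓ hgm hgl hg0 hΓg (δ j) (hδ j) a)
  have hul : LocallyIntegrable u volume := by
    intro t
    refine ⟨Icc (t - 1 / 2) (t - 1 / 2 + 1), Icc_mem_nhds (by linarith) (by linarith),
      hum.aestronglyMeasurable, (hunit _).trans_lt ENNReal.ofReal_lt_top⟩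
  refine ⟨u, hum, hul, fun p q => ?_, hunit⟩
  have hMw : ∀ s, Tendsto (fun j => M j s) atTop (𝓝 (w s)) := by
    intro s
    have : Tendsto (fun j => max (w s) (Γ s + δ j)) atTop (𝓝 (max (w s) (Γ s + 0))) :=
      tendsto_const_nhds.max (tendsto_const_nhds.add hδ0)
    rwa [add_zero, max_eq_left (le_logMaximal (μ := μ) hΓ s)] at this
  have hftc : ∀ j, ∫ x in p..q, deriv (M j) x = M j q - M j p := by
    intro j
    rcases le_total p q with h | h
    · exact (hMac j p q h).integral_deriv_eq_sub
    · exact (hMac j q p h).symm.integral_deriv_eq_sub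
  have hΓi : IntervalIntegrable (deriv Γ) volume p q := by
    rcases le_total p q with h | h
    · exact (hΓac p q h).intervalIntegrable_deriv
    · exact (hΓac q p h).intervalIntegrable_deriv.symm
  have hui : IntervalIntegrable u volume p q :=
    (hul.integrableOn_isCompact isCompact_uIcc).intervalIntegrable
  refine tendsto_nhds_unique ((hMw q).sub (hMw p)) ?_
  simp_rw [← hftc]
  refine intervalIntegral.tendsto_integral_filter_of_dominated_convergence
    (fun t => ‖u t‖ + ‖deriv Γ t‖)
    (Eventually.of_forall fun j => (measurable_deriv (M j)).aestronglyMeasurable)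
    (Eventually.of_forall fun j => ?_) (hui.norm.add hΓi.norm) ?_
  · filter_upwards [hbound] with t ht _ using ht j
  · filter_upwards [hlim] with t ht _ using ht

end LogMaximal

/-! ### Spherical means and radial test functions -/

section LogPolar

variable {E : Type*} [NormedAddCommGroup E] [NormedSpace ℝ E] [FiniteDimensional ℝ E]
  [MeasurableSpace E] [BorelSpace E] [Nontrivial E] {μ : Measure E} [μ.IsAddHaarMeasure]
  {F : E → ℝ}

theorem integrable_comp_exp_smul_sphere (hF : Integrable F μ) :
    Integrable (fun p : ℝ × sphere (0 : E) 1 => F (Real.exp p.1 • (p.2 : E)))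
      ((logRadialMeasure E).prod μ.toSphere) :=
  (measurePreserving_exp_smul_sphere μ).integrable_comp_of_integrable hF

theorem integrable_exp_mul_integral_sphere (hF : Integrable F μ) :
    Integrable fun s => Real.exp (Module.finrank ℝ E * s) *
      ∫ θ : sphere (0 : E) 1, F (Real.exp s • (θ : E)) ∂μ.toSphere := by
  have h := (integrable_comp_exp_smul_sphere hF).integral_prod_left
  rw [logRadialMeasure, integrable_withDensity_iff_integrable_smul' (by fun_prop)
    (Eventually.of_forall fun s => ENNReal.ofReal_lt_top)] at h
  refine h.congr (Eventually.of_forall fun s => ?_)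
  simp [ENNReal.toReal_ofReal, Real.exp_nonneg]

theorem integral_eq_integral_exp_mul_integral_sphere (hF : Integrable F μ) :
    ∫ x, F x ∂μ = ∫ s, Real.exp (Module.finrank ℝ E * s) *
      ∫ θ : sphere (0 : E) 1, F (Real.exp s • (θ : E)) ∂μ.toSphere := by
  have hmp := measurePreserving_exp_smul_sphere μ
  have h1 : ∫ x, F x ∂μ = ∫ p : ℝ × sphere (0 : E) 1, F (Real.exp p.1 • (p.2 : E))
      ∂((logRadialMeasure E).prod μ.toSphere) := by
    conv_lhs => rw [← hmp.map_eq]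
    rw [integral_map hmp.measurable.aemeasurable]
    rw [hmp.map_eq]
    exact hF.aestronglyMeasurable
  rw [h1, integral_prod _ (integrable_comp_exp_smul_sphere hF), logRadialMeasure]
  rw [integral_withDensity_eq_integral_toReal_smul (by fun_prop)
    (Eventually.of_forall fun s => ENNReal.ofReal_lt_top)]
  refine integral_congr_ae (Eventually.of_forall fun s => ?_)
  simp [ENNReal.toReal_ofReal, Real.exp_nonneg]

theorem integral_abs_exp_mul_integral_sphere_le (hF : Integrable F μ) :
    ∫ s, |Real.exp (Module.finrank ℝ E * s) *
      ∫ θ : sphere (0 : E) 1, F (Real.exp s • (θ : E)) ∂μ.toSphere| ≤ ∫ x, |F x| ∂μ := by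
  rw [integral_eq_integral_exp_mul_integral_sphere (F := fun x => |F x|) hF.abs]
  refine integral_mono (integrable_exp_mul_integral_sphere hF).abs
    (integrable_exp_mul_integral_sphere hF.abs) fun s => ?_
  simp only [abs_mul, Real.abs_exp]
  exact mul_le_mul_of_nonneg_left abs_integral_le_integral_abs (Real.exp_nonneg _)

theorem locallyIntegrable_integral_sphere (hF : Integrable F μ) :
    LocallyIntegrable fun s => ∫ θ : sphere (0 : E) 1, F (Real.exp s • (θ : E)) ∂μ.toSphere := by
  have h := (integrable_exp_mul_integral_sphere hF).locallyIntegrable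
  have h2 := (h.locallyIntegrableOn univ).continuousOn_mul
    (g := fun s => Real.exp (-(Module.finrank ℝ E * s)))
    (by fun_prop) isOpen_univ.isLocallyClosed
  rw [locallyIntegrableOn_univ] at h2
  refine h2.congr (Eventually.of_forall fun s => ?_)
  simp only
  rw [← mul_assoc, ← Real.exp_add, neg_add_cancel, Real.exp_zero, one_mul]

end LogPolar

section LogRadial

variable {E : Type*} [NormedAddCommGroup E]

open scoped Classical in
/-- The radial function `x ↦ h (log ‖x‖)`, with the prescribed value `c` at the origin. -/
noncomputable def logRadial (h : ℝ → ℝ) (c : ℝ) (x : E) : ℝ :=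
  if x = 0 then c else h (Real.log ‖x‖)

variable {h h' : ℝ → ℝ} {c R : ℝ}

theorem logRadial_of_ne {x : E} (hx : x ≠ 0) : logRadial h c x = h (Real.log ‖x‖) :=
  if_neg hx

theorem logRadial_eventuallyEq_of_ne {x : E} (hx : x ≠ 0) :
    logRadial h c =ᶠ[𝓝 x] fun y => h (Real.log ‖y‖) := by
  filter_upwards [isOpen_ne.mem_nhds hx] with y hy using logRadial_of_ne hy

theorem logRadial_eventuallyEq_zero (hc : ∀ s ≤ -R, h s = c) :
    (logRadial h c : E → ℝ) =ᶠ[𝓝 0] fun _ => c := by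
  filter_upwards [ball_mem_nhds (0 : E) (Real.exp_pos (-R))] with y hy
  by_cases h0 : y = 0
  · rw [logRadial, if_pos h0]
  · rw [logRadial_of_ne h0]
    refine hc _ ?_
    rw [Real.log_le_iff_le_exp (norm_pos_iff.2 h0)]
    simpa using (mem_ball_zero_iff.1 hy).le

variable [InnerProductSpace ℝ E]

theorem contDiff_logRadial (hh : ContDiff ℝ ∞ h) (hc : ∀ s ≤ -R, h s = c) :
    ContDiff ℝ ∞ (logRadial h c : E → ℝ) := by
  rw [contDiff_iff_contDiffAt]
  intro x
  by_cases hx : x = 0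
  · subst hx
    exact contDiffAt_const.congr_of_eventuallyEq (logRadial_eventuallyEq_zero hc)
  · refine ContDiffAt.congr_of_eventuallyEq ?_ (logRadial_eventuallyEq_of_ne hx)
    exact hh.contDiffAt.comp x ((contDiffAt_norm ℝ hx).log (norm_ne_zero_iff.2 hx))

theorem fderiv_logRadial (hh : ∀ s, HasDerivAt h (h' s) s) (hc : ∀ s ≤ -R, h s = c) (x v : E) :
    fderiv ℝ (logRadial h c) x v = h' (Real.log ‖x‖) * inner ℝ x v / ‖x‖ ^ 2 := by
  by_cases hx : x = 0
  · subst hx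
    rw [(logRadial_eventuallyEq_zero hc).fderiv_eq]
    simp
  · have hn : ‖x‖ ≠ 0 := norm_ne_zero_iff.2 hx
    -- `log ‖y‖ = log (‖y‖ ^ 2) / 2`, and the squared norm is differentiable with an explicit
    -- derivative.
    have e : (logRadial h c) =ᶠ[𝓝 x] fun y : E => h (Real.log (‖y‖ ^ 2) / 2) := by
      filter_upwards [logRadial_eventuallyEq_of_ne (h := h) (c := c) hx] with y hy
      rw [hy, Real.log_pow]
      norm_num
    have hsq : ‖x‖ ^ 2 ≠ 0 := pow_ne_zero 2 hn
    have d1 := ((hasStrictFDerivAt_norm_sq x).hasFDerivAt.log hsq).mul_const (2⁻¹ : ℝ)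
    have hlog : Real.log (‖x‖ ^ 2) * 2⁻¹ = Real.log ‖x‖ := by
      rw [Real.log_pow]; push_cast; ring
    have d2 : HasFDerivAt (fun y : E => h (Real.log (‖y‖ ^ 2) * 2⁻¹)) _ x :=
      (hh (Real.log (‖x‖ ^ 2) * 2⁻¹)).comp_hasFDerivAt x d1
    simp_rw [div_eq_mul_inv] at e
    rw [e.fderiv_eq, d2.fderiv, hlog]
    simp
    field_simp

theorem hasCompactSupport_logRadial [FiniteDimensional ℝ E] (hR : ∀ s, R ≤ s → h s = 0) :
    HasCompactSupport (logRadial h c : E → ℝ) := by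
  have : ProperSpace E := FiniteDimensional.proper ℝ E
  refine HasCompactSupport.intro (isCompact_closedBall (0 : E) (Real.exp R)) fun x hx => ?_
  rw [mem_closedBall_zero_iff, not_le] at hx
  have hn : 0 < ‖x‖ := (Real.exp_pos R).trans hx
  rw [logRadial_of_ne (norm_pos_iff.1 hn)]
  exact hR _ ((Real.le_log_iff_exp_le hn).2 hx.le)

end LogRadial

/-! ### The profile of a radial Sobolev function -/

section Profile

variable {n : ℕ} {f : EuclideanSpace ℝ (Fin n) → ℝ}
  {G : EuclideanSpace ℝ (Fin n) → EuclideanSpace ℝ (Fin n)}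

/-- The weak gradient tested against the field `ψ (log ‖x‖) ‖x‖ ^ (-n) x`, whose divergence is
`ψ' (log ‖x‖) ‖x‖ ^ (-n)`. -/
theorem HasWeakGradient.integral_mul_deriv_comp_log_norm (hn : 1 ≤ n) (hw : HasWeakGradient f G)
    {ψ : ℝ → ℝ} (hψ : ContDiff ℝ ∞ ψ) (hψc : HasCompactSupport ψ) :
    ∫ x, f x * (deriv ψ (Real.log ‖x‖) * Real.exp (-(n * Real.log ‖x‖))) =
      -∫ x, inner ℝ (G x) x * (ψ (Real.log ‖x‖) * Real.exp (-(n * Real.log ‖x‖))) := by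
  have : Nonempty (Fin n) := ⟨⟨0, hn⟩⟩
  obtain ⟨R, hR, hsub⟩ : ∃ R > 0, ∀ x, R ≤ |x| → ψ x = 0 := hψc.exists_pos_le_norm
  -- The field is `η x • x` with `η` the radial function of profile `h`; its coordinates `η x * x i`
  -- are test functions.
  set h : ℝ → ℝ := fun s => ψ s * Real.exp (-(n * s)) with hh
  set h' : ℝ → ℝ := fun s => (deriv ψ s - n * ψ s) * Real.exp (-(n * s)) with hh'
  have hhs : ContDiff ℝ ∞ h := hψ.mul (by fun_prop)
  have hhd : ∀ s, HasDerivAt h (h' s) s := fun s => by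
    have d1 := (hψ.differentiable (by norm_num) s).hasDerivAt
    have d2 : HasDerivAt (fun s : ℝ => Real.exp (-(n * s))) (Real.exp (-(n * s)) * (-(n * 1))) s :=
      (((hasDerivAt_id s).const_mul (n : ℝ)).neg).exp
    exact (d1.fun_mul d2).congr_deriv (by simp only [hh']; ring)
  have hl : ∀ s ≤ -R, h s = 0 := fun s hs => by
    simp [hh, hsub s (by rw [abs_of_nonpos] <;> linarith)]
  have hr : ∀ s, R ≤ s → h s = 0 := fun s hs => by
    simp [hh, hsub s (by rw [abs_of_nonneg] <;> linarith)]
  set η : EuclideanSpace ℝ (Fin n) → ℝ := logRadial h 0 with hη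
  have hηs : ContDiff ℝ ∞ η := contDiff_logRadial hhs hl
  have hηc : HasCompactSupport η := hasCompactSupport_logRadial hr
  have hφs : ∀ i, ContDiff ℝ ∞ fun x => η x * x i := fun i =>
    hηs.mul (by fun_prop)
  have hφc : ∀ i, HasCompactSupport fun x => η x * x i := fun i => hηc.mul_right
  have hφd : ∀ i x, fderiv ℝ (fun x => η x * x i) x (EuclideanSpace.single i 1) =
      h' (Real.log ‖x‖) * x i ^ 2 / ‖x‖ ^ 2 + η x := fun i x => by
    have d1 := (hηs.differentiable (by norm_num) x).hasFDerivAt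
    have d2 : HasFDerivAt (fun x : EuclideanSpace ℝ (Fin n) => x i)
      (EuclideanSpace.proj i : EuclideanSpace ℝ (Fin n) →L[ℝ] ℝ) x :=
      (EuclideanSpace.proj i : EuclideanSpace ℝ (Fin n) →L[ℝ] ℝ).hasFDerivAt
    rw [(d1.fun_mul d2).fderiv]
    simp only [add_apply, smul_apply, smul_eq_mul]
    rw [hη, fderiv_logRadial hhd hl]
    simp [EuclideanSpace.inner_single_right]
    ring
  have hint1 : ∀ i, Integrable fun x =>
      f x * fderiv ℝ (fun x => η x * x i) x (EuclideanSpace.single i 1) := fun i => by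
    have hc : Continuous fun x => fderiv ℝ (fun x => η x * x i) x (EuclideanSpace.single i 1) :=
      ((hφs i).continuous_fderiv (by norm_num)).clm_apply continuous_const
    have hcs : HasCompactSupport fun x =>
        fderiv ℝ (fun x => η x * x i) x (EuclideanSpace.single i 1) :=
      (hφc i).fderiv_apply ℝ _
    refine (hw.locallyIntegrable.integrable_smul_left_of_hasCompactSupport hc hcs).congr ?_
    exact Eventually.of_forall fun x => by simp [mul_comm]
  have hint2 : ∀ i, Integrable fun x =>
      inner ℝ (G x) (EuclideanSpace.single i 1) * (η x * x i) := fun i => by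
    have := (hw.locallyIntegrable_grad.integrable_smul_left_of_hasCompactSupport
      (hφs i).continuous (hφc i)).inner_const (𝕜 := ℝ) (EuclideanSpace.single i (1 : ℝ))
    refine this.congr (Eventually.of_forall fun x => ?_)
    simp only
    rw [real_inner_smul_left, mul_comm]
  have hsum : ∑ i, ∫ x, f x * fderiv ℝ (fun x => η x * x i) x (EuclideanSpace.single i 1) =
      ∑ i, -∫ x, inner ℝ (G x) (EuclideanSpace.single i 1) * (η x * x i) :=
    Finset.sum_congr rfl fun i _ => hw.integral_eq _ (hφs i) (hφc i) _
  rw [Finset.sum_neg_distrib, ← integral_finsetSum _ fun i _ => hint1 i,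
    ← integral_finsetSum _ fun i _ => hint2 i] at hsum
  have hne : ∀ᵐ x : EuclideanSpace ℝ (Fin n), x ≠ 0 := Measure.ae_ne volume 0
  have hnsq : ∀ x : EuclideanSpace ℝ (Fin n), ∑ i, x i ^ 2 = ‖x‖ ^ 2 := fun x =>
    (EuclideanSpace.real_norm_sq_eq x).symm
  refine (integral_congr_ae ?_).trans (hsum.trans (neg_inj.2 (integral_congr_ae ?_)))
  · filter_upwards [hne] with x hx
    have hx2 : ‖x‖ ^ 2 ≠ 0 := pow_ne_zero 2 (norm_ne_zero_iff.2 hx)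
    rw [← Finset.mul_sum]
    simp_rw [hφd]
    rw [Finset.sum_add_distrib, ← Finset.sum_div, ← Finset.mul_sum, hnsq,
      mul_div_cancel_right₀ _ hx2, hη, logRadial_of_ne hx]
    simp [hh, hh']
    left; ring
  · filter_upwards [hne] with x hx
    have e1 : inner ℝ (G x) x = ∑ i, G x i * x i := by
      rw [PiLp.inner_apply]
      exact Finset.sum_congr rfl fun i _ => by simp [mul_comm]
    rw [e1, Finset.sum_mul, hη, logRadial_of_ne hx]
    refine Finset.sum_congr rfl fun i _ => ?_
    simp [EuclideanSpace.inner_single_right, hh]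
    ring

end Profile

section Profile

variable {n : ℕ} {f : EuclideanSpace ℝ (Fin n) → ℝ}
  {G : EuclideanSpace ℝ (Fin n) → EuclideanSpace ℝ (Fin n)}

/-- Integration against `k (log ‖x‖) ‖x‖ ^ (-n)`. -/
theorem integral_mul_comp_log_norm {E : Type*} [NormedAddCommGroup E] [NormedSpace ℝ E]
    [FiniteDimensional ℝ E] [MeasurableSpace E] [BorelSpace E] [Nontrivial E] {μ : Measure E}
    [μ.IsAddHaarMeasure] {F : E → ℝ} (hF : Integrable F μ) {k : ℝ → ℝ} (hk : Continuous k)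
    (hkc : HasCompactSupport k) :
    ∫ x, F x * (k (Real.log ‖x‖) * Real.exp (-(Module.finrank ℝ E * Real.log ‖x‖))) ∂μ =
      ∫ s, (∫ θ : sphere (0 : E) 1, F (Real.exp s • (θ : E)) ∂μ.toSphere) * k s := by
  set d := Module.finrank ℝ E
  set K : ℝ → ℝ := fun s => k s * Real.exp (-(d * s)) with hK
  have hKc : Continuous K := by fun_prop
  have hKs : HasCompactSupport K := hkc.mul_right
  obtain ⟨B, hB⟩ := hKc.bounded_above_of_compact_support hKs
  have hi : Integrable (fun x => F x * K (Real.log ‖x‖)) μ :=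
    hF.mul_bdd (c := B) (hKc.measurable.comp (by fun_prop)).aestronglyMeasurable
      (Eventually.of_forall fun x => hB _)
  rw [integral_eq_integral_exp_mul_integral_sphere hi]
  refine integral_congr_ae (Eventually.of_forall fun s => ?_)
  simp only [norm_exp_smul_sphere, Real.log_exp]
  rw [integral_mul_const, hK]
  simp only
  have : Real.exp (d * s) * Real.exp (-(d * s)) = 1 := by
    rw [← Real.exp_add, add_neg_cancel, Real.exp_zero]
  linear_combination (∫ θ : sphere (0 : E) 1, F (Real.exp s • (θ : E)) ∂μ.toSphere) * k s * this

/-- A radial function with integrable weak gradient has an absolutely continuous profile in the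
coordinate `log ‖x‖`, whose derivative is the spherical mean of the radial part of the gradient. -/
theorem HasWeakGradient.exists_log_profile (hn : 1 ≤ n) (hw : HasWeakGradient f G)
    (hf : Integrable f) (hG : Integrable G) (hr : IsRadial f) :
    ∃ (c : ℝ) (γ : ℝ → ℝ), Measurable γ ∧ LocallyIntegrable γ ∧
      (∀ᵐ x, f x = c + ∫ t in (0 : ℝ)..Real.log ‖x‖, γ t) ∧
      Integrable (fun s => Real.exp ((n - 1) * s) * γ s) ∧
      (volume : Measure (EuclideanSpace ℝ (Fin n))).toSphere.real univ *
        ∫ s, Real.exp ((n - 1) * s) * |γ s| ≤ ∫ x, ‖G x‖ := by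
  have : Nonempty (Fin n) := ⟨⟨0, hn⟩⟩
  have hdim : Module.finrank ℝ (EuclideanSpace ℝ (Fin n)) = n := finrank_euclideanSpace_fin
  set σ := (volume : Measure (EuclideanSpace ℝ (Fin n))).toSphere with hσ
  have hσpos : 0 < σ.real univ := by
    rw [measureReal_def]
    refine ENNReal.toReal_pos ?_ (measure_ne_top _ _)
    rw [Ne, Measure.measure_univ_eq_zero]
    exact Measure.toSphere_ne_zero _
  -- A strongly measurable representative makes the profile measurable.
  set D : EuclideanSpace ℝ (Fin n) → EuclideanSpace ℝ (Fin n) := hG.1.mk G with hD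
  have hDm : StronglyMeasurable D := hG.1.stronglyMeasurable_mk
  have hGD : G =ᵐ[volume] D := hG.1.ae_eq_mk
  have hDi : Integrable D := hG.congr hGD
  set F : EuclideanSpace ℝ (Fin n) → ℝ := fun x => inner ℝ (D x) (‖x‖⁻¹ • x) with hF
  have hFm : StronglyMeasurable F := by
    refine StronglyMeasurable.inner hDm (Measurable.stronglyMeasurable ?_)
    fun_prop
  have hunit : ∀ x : EuclideanSpace ℝ (Fin n), ‖‖x‖⁻¹ • x‖ ≤ 1 := fun x => by
    rw [norm_smul, norm_inv, norm_norm]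
    exact inv_mul_le_one
  have hFle : ∀ x, ‖F x‖ ≤ ‖D x‖ := fun x =>
    (norm_inner_le_norm _ _).trans (mul_le_of_le_one_right (norm_nonneg _) (hunit x))
  have hFi : Integrable F := hDi.mono hFm.aestronglyMeasurable (Eventually.of_forall hFle)
  -- `A u s` is the integral of `u (e ^ s • θ)` over the unit sphere, so that `g` below is the
  -- profile of `f`.
  set A : (EuclideanSpace ℝ (Fin n) → ℝ) → ℝ → ℝ := fun u s =>
    ∫ θ : sphere (0 : EuclideanSpace ℝ (Fin n)) 1,
      u (Real.exp s • (θ : EuclideanSpace ℝ (Fin n))) ∂σ with hA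
  set γ : ℝ → ℝ := fun s => (σ.real univ)⁻¹ * (Real.exp s * A F s) with hγ
  set g : ℝ → ℝ := fun s => (σ.real univ)⁻¹ * A f s with hg
  have hAFm : Measurable (A F) := by
    refine StronglyMeasurable.measurable ?_
    refine StronglyMeasurable.integral_prod_right
      (f := fun s (θ : sphere (0 : EuclideanSpace ℝ (Fin n)) 1) =>
        F (Real.exp s • (θ : EuclideanSpace ℝ (Fin n)))) ?_
    exact hFm.comp_measurable (g := fun p : ℝ × sphere (0 : EuclideanSpace ℝ (Fin n)) 1 =>
      Real.exp p.1 • (p.2 : EuclideanSpace ℝ (Fin n))) (by fun_prop)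
  have hγm : Measurable γ := by fun_prop
  have hgl : LocallyIntegrable g :=
    (locallyIntegrable_integral_sphere hf).smul ((σ.real univ)⁻¹)
  have hγl : LocallyIntegrable γ := by
    have h := ((locallyIntegrable_integral_sphere hFi).locallyIntegrableOn univ).continuousOn_mul
      (g := fun s => (σ.real univ)⁻¹ * Real.exp s) (by fun_prop) isOpen_univ.isLocallyClosed
    rw [locallyIntegrableOn_univ] at h
    exact h.congr (Eventually.of_forall fun s => by simp only [hγ, hA]; ring)
  have hweak : ∀ ψ : ℝ → ℝ, ContDiff ℝ ∞ ψ → HasCompactSupport ψ →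
      ∫ s, g s * deriv ψ s = -∫ s, γ s * ψ s := by
    intro ψ hψ hψc
    have h := hw.integral_mul_deriv_comp_log_norm hn hψ hψc
    have h1 := integral_mul_comp_log_norm (μ := (volume : Measure (EuclideanSpace ℝ (Fin n)))) hf
      (hψ.continuous_deriv (by norm_cast)) hψc.deriv
    have h2 := integral_mul_comp_log_norm (μ := (volume : Measure (EuclideanSpace ℝ (Fin n)))) hFi
      (k := fun s => Real.exp s * ψ s) (by fun_prop) hψc.mul_left
    rw [hdim] at h1 h2
    rw [h1] at h
    have h3 : ∫ x, inner ℝ (G x) x * (ψ (Real.log ‖x‖) * Real.exp (-(n * Real.log ‖x‖))) =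
        ∫ x, F x * (Real.exp (Real.log ‖x‖) * ψ (Real.log ‖x‖) *
          Real.exp (-(n * Real.log ‖x‖))) := by
      refine integral_congr_ae ?_
      filter_upwards [hGD, Measure.ae_ne volume (0 : EuclideanSpace ℝ (Fin n))] with x hx hx0
      have hx1 : 0 < ‖x‖ := norm_pos_iff.2 hx0
      rw [hx, Real.exp_log hx1]
      simp only [hF]
      rw [real_inner_smul_right]
      field_simp
    rw [h3, h2] at h
    have e1 : ∫ s, g s * deriv ψ s = (σ.real univ)⁻¹ * ∫ s, A f s * deriv ψ s := by
      rw [← integral_const_mul]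
      exact integral_congr_ae (Eventually.of_forall fun s => by simp only [hg]; ring)
    have e2 : ∫ s, γ s * ψ s = (σ.real univ)⁻¹ * ∫ s, A F s * (Real.exp s * ψ s) := by
      rw [← integral_const_mul]
      exact integral_congr_ae (Eventually.of_forall fun s => by simp only [hγ]; ring)
    rw [e1, e2, ← mul_neg]
    exact congrArg _ h
  obtain ⟨c, hc⟩ := exists_ae_eq_add_integral_of_weak_deriv hgl hγl hweak
  have hexp : ∀ s, Real.exp ((n - 1) * s) * γ s =
      (σ.real univ)⁻¹ *
        (Real.exp (Module.finrank ℝ (EuclideanSpace ℝ (Fin n)) * s) * A F s) := fun s => by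
    have : Real.exp (Module.finrank ℝ (EuclideanSpace ℝ (Fin n)) * s) =
        Real.exp ((n - 1) * s) * Real.exp s := by
      rw [hdim, ← Real.exp_add]; congr 1; ring
    rw [this]; simp only [hγ]; ring
  refine ⟨c, γ, hγm, hγl, ?_, ?_, ?_⟩
  · obtain ⟨g₀, hg₀⟩ := hr
    have h1 : ∀ᵐ p ∂(logRadialMeasure (EuclideanSpace ℝ (Fin n))).prod σ,
        f (Real.exp p.1 • (p.2 : EuclideanSpace ℝ (Fin n))) = g₀ (Real.exp p.1) := by
      have := (measurePreserving_exp_smul_sphere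
        (volume : Measure (EuclideanSpace ℝ (Fin n)))).quasiMeasurePreserving.ae hg₀
      filter_upwards [this] with p hp
      rw [hp, norm_exp_smul_sphere]
    have h2 : ∀ᵐ s, g s = g₀ (Real.exp s) := by
      rw [← ae_volume_iff_ae_logRadialMeasure (E := EuclideanSpace ℝ (Fin n))]
      filter_upwards [Measure.ae_ae_of_ae_prod h1] with s hs
      simp only [hg, hA]
      rw [integral_congr_ae hs, integral_const, smul_eq_mul, ← mul_assoc,
        inv_mul_cancel₀ hσpos.ne', one_mul]
    have h3 : ∀ᵐ s, g₀ (Real.exp s) = c + ∫ t in (0 : ℝ)..s, γ t := by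
      filter_upwards [h2, hc] with s hs1 hs2
      rw [← hs1, hs2]
    filter_upwards [hg₀, ae_comp_log_norm volume h3,
      Measure.ae_ne volume (0 : EuclideanSpace ℝ (Fin n))] with x hx1 hx2 hx0
    rw [hx1, ← hx2, Real.exp_log (norm_pos_iff.2 hx0)]
  · simp_rw [hexp]
    exact (integrable_exp_mul_integral_sphere hFi).const_mul _
  · have e : ∫ s, Real.exp ((n - 1) * s) * |γ s| =
        (σ.real univ)⁻¹ *
          ∫ s, |Real.exp (Module.finrank ℝ (EuclideanSpace ℝ (Fin n)) * s) * A F s| := by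
      rw [← integral_const_mul]
      refine integral_congr_ae (Eventually.of_forall fun s => ?_)
      simp only
      rw [← Real.abs_exp ((n - 1) * s), ← abs_mul, hexp, abs_mul, abs_of_pos (inv_pos.2 hσpos)]
    rw [e, ← mul_assoc, mul_inv_cancel₀ hσpos.ne', one_mul]
    refine (integral_abs_exp_mul_integral_sphere_le hFi).trans ?_
    exact (integral_mono hFi.abs hDi.norm hFle).trans
      (le_of_eq (integral_congr_ae (hGD.symm.fun_comp norm)))

end Profile

/-! ### Weak differentiability of radial functions with absolutely continuous profile -/

theorem integral_indicator_log_norm_lt_right {E : Type*} [NormedAddCommGroup E] {u : ℝ → ℝ}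
    {S : ℝ} {κ : E → ℝ} (x : E) (hx : Real.log ‖x‖ ≤ S) :
    ∫ τ, {p : E × ℝ | Real.log ‖p.1‖ < p.2 ∧ p.2 ≤ S}.indicator (fun p => u p.2 * κ p.1) (x, τ) =
      (∫ τ in (Real.log ‖x‖)..S, u τ) * κ x := by
  rw [intervalIntegral.integral_of_le hx, ← integral_mul_const,
    ← integral_indicator measurableSet_Ioc]
  refine integral_congr_ae (Eventually.of_forall fun τ => ?_)
  simp only [indicator]
  congr 1

section LogPolar

variable {E : Type*} [NormedAddCommGroup E] [NormedSpace ℝ E] [FiniteDimensional ℝ E]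
  [MeasurableSpace E] [BorelSpace E] [Nontrivial E] {μ : Measure E} [μ.IsAddHaarMeasure]
  {k u : ℝ → ℝ}

theorem integrable_comp_log_norm (hk : Measurable k)
    (hi : Integrable fun s => Real.exp (Module.finrank ℝ E * s) * k s) :
    Integrable (fun x => k (Real.log ‖x‖)) μ := by
  refine ⟨(hk.comp (by fun_prop)).aestronglyMeasurable, ?_⟩
  have h := lintegral_comp_log_norm μ (F := fun s => ‖k s‖ₑ) (by fun_prop)
  rw [HasFiniteIntegral, h]
  refine ENNReal.mul_lt_top (measure_lt_top _ _) ?_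
  have h2 := hi.2
  rw [HasFiniteIntegral] at h2
  convert h2 using 3 with s
  rw [enorm_mul, Real.enorm_of_nonneg (Real.exp_nonneg _)]

theorem integral_comp_log_norm (hi : Integrable (fun x => k (Real.log ‖x‖)) μ) :
    ∫ x, k (Real.log ‖x‖) ∂μ = μ.toSphere.real univ *
      ∫ s, Real.exp (Module.finrank ℝ E * s) * k s := by
  rw [integral_eq_integral_exp_mul_integral_sphere hi, ← integral_const_mul]
  refine integral_congr_ae (Eventually.of_forall fun s => ?_)
  simp only [norm_exp_smul_sphere, Real.log_exp, integral_const, smul_eq_mul]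
  ring

theorem measure_log_norm_lt_le (μ : Measure E) [μ.IsAddHaarMeasure] (τ : ℝ) :
    μ {x : E | Real.log ‖x‖ < τ} ≤
      ENNReal.ofReal (Real.exp (Module.finrank ℝ E * τ)) * μ (ball 0 1) := by
  have h : {x : E | Real.log ‖x‖ < τ} ≤ᵐ[μ] ball (0 : E) (Real.exp τ) := by
    filter_upwards [Measure.ae_ne μ (0 : E)] with x hx0 hx
    exact mem_ball_zero_iff.2 ((Real.log_lt_iff_lt_exp (norm_pos_iff.2 hx0)).1 hx)
  refine (measure_mono_ae h).trans (le_of_eq ?_)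
  rw [Measure.addHaar_ball μ 0 (Real.exp_nonneg _), ← Real.exp_nat_mul]

/-- The slice at `τ` is supported in the ball of radius `e ^ τ`, whose volume is a multiple of
`e ^ τ * e ^ ((n - 1) τ)`; the factor `e ^ τ` to spare is bounded for `τ ≤ S`. -/
theorem integrable_indicator_log_norm_lt (hu : Measurable u)
    (hi : Integrable fun s => Real.exp ((Module.finrank ℝ E - 1) * s) * u s) {κ : E → ℝ}
    (hκ : Measurable κ) {B : ℝ} (hB : ∀ x, ‖κ x‖ ≤ B) (S : ℝ) :
    Integrable ({p : E × ℝ | Real.log ‖p.1‖ < p.2 ∧ p.2 ≤ S}.indicator fun p => u p.2 * κ p.1)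
      (μ.prod volume) := by
  set T := {p : E × ℝ | Real.log ‖p.1‖ < p.2 ∧ p.2 ≤ S} with hT
  have hTm : MeasurableSet T := by
    have h1 : MeasurableSet {p : E × ℝ | Real.log ‖p.1‖ < p.2} :=
      measurableSet_lt (by fun_prop) (by fun_prop)
    have h2 : MeasurableSet {p : E × ℝ | p.2 ≤ S} := measurableSet_le (by fun_prop) (by fun_prop)
    exact h1.inter h2
  have hm : Measurable (T.indicator fun p => u p.2 * κ p.1) :=
    Measurable.indicator (by fun_prop) hTm
  refine ⟨hm.aestronglyMeasurable, ?_⟩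
  rw [HasFiniteIntegral, lintegral_prod_symm _ (by fun_prop)]
  have hpt : ∀ τ, ∫⁻ x, ‖T.indicator (fun p => u p.2 * κ p.1) (x, τ)‖ₑ ∂μ ≤
      ENNReal.ofReal B * ENNReal.ofReal (Real.exp S) * μ (ball 0 1) *
        ‖Real.exp ((Module.finrank ℝ E - 1) * τ) * u τ‖ₑ := by
    intro τ
    by_cases hτ : τ ≤ S
    · calc ∫⁻ x, ‖T.indicator (fun p => u p.2 * κ p.1) (x, τ)‖ₑ ∂μ
          ≤ ∫⁻ x, {x : E | Real.log ‖x‖ < τ}.indicator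
              (fun _ => ENNReal.ofReal B * ‖u τ‖ₑ) x ∂μ := by
            refine lintegral_mono fun x => ?_
            by_cases hx : Real.log ‖x‖ < τ
            · rw [indicator_of_mem (show (x, τ) ∈ T from ⟨hx, hτ⟩), indicator_of_mem
                (show x ∈ {x : E | Real.log ‖x‖ < τ} from hx), enorm_mul,
                mul_comm]
              gcongr
              rw [← ofReal_norm]
              exact ENNReal.ofReal_le_ofReal (hB x)
            · rw [indicator_of_notMem fun h : (x, τ) ∈ T => hx h.1]
              simp
        _ = ENNReal.ofReal B * ‖u τ‖ₑ * μ {x : E | Real.log ‖x‖ < τ} :=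
            lintegral_indicator_const (measurableSet_lt (by fun_prop) (by fun_prop)) _
        _ ≤ ENNReal.ofReal B * ‖u τ‖ₑ *
              (ENNReal.ofReal (Real.exp (Module.finrank ℝ E * τ)) * μ (ball 0 1)) := by
            gcongr
            exact measure_log_norm_lt_le μ τ
        _ ≤ ENNReal.ofReal B * ‖u τ‖ₑ * (ENNReal.ofReal (Real.exp S *
              Real.exp ((Module.finrank ℝ E - 1) * τ)) * μ (ball 0 1)) := by
            gcongr
            rw [← Real.exp_add]
            refine Real.exp_le_exp.2 ?_
            linarith
        _ = _ := by
            rw [enorm_mul, Real.enorm_of_nonneg (Real.exp_nonneg _),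
              ENNReal.ofReal_mul (Real.exp_nonneg _)]
            ring
    · have : ∀ x, T.indicator (fun p => u p.2 * κ p.1) (x, τ) = 0 := fun x =>
        indicator_of_notMem (fun h : (x, τ) ∈ T => hτ h.2) _
      simp [this]
  refine (lintegral_mono hpt).trans_lt ?_
  rw [lintegral_const_mul _ (by fun_prop)]
  exact ENNReal.mul_lt_top (ENNReal.mul_lt_top (by finiteness) measure_ball_lt_top) hi.2

end LogPolar

section SphereFlux

variable {E : Type*} [NormedAddCommGroup E] [InnerProductSpace ℝ E] [FiniteDimensional ℝ E]
  [MeasurableSpace E] [BorelSpace E]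
  {φ : E → ℝ}

theorem integral_fderiv_eq_zero (μ : Measure E) [μ.IsAddHaarMeasure] (hφ : ContDiff ℝ ∞ φ)
    (hφc : HasCompactSupport φ) (v : E) : ∫ x, fderiv ℝ φ x v ∂μ = 0 := by
  have hc : Continuous fun x => fderiv ℝ φ x v :=
    (hφ.continuous_fderiv (by norm_num)).clm_apply continuous_const
  have := integral_mul_fderiv_eq_neg_fderiv_mul_of_integrable (μ := μ) (f := fun _ : E => (1 : ℝ))
    (g := φ) (v := v) (by simp)
    (by simpa using hc.integrable_of_hasCompactSupport (hφc.fderiv_apply ℝ v))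
    (by simpa using hφ.continuous.integrable_of_hasCompactSupport hφc)
    (fun x _ => by fun_prop) (fun x _ => hφ.differentiable (by norm_num) x)
  simpa using this

variable [Nontrivial E]

/-- The divergence theorem for the field `φ v` on almost every ball centred at the origin. It is
obtained by testing with smooth radial functions. -/
theorem ae_integral_log_norm_lt_fderiv (μ : Measure E) [μ.IsAddHaarMeasure] (hφ : ContDiff ℝ ∞ φ)
    (hφc : HasCompactSupport φ) (v : E) :
    ∀ᵐ τ : ℝ, ∫ x, {x : E | Real.log ‖x‖ < τ}.indicator (fun x => fderiv ℝ φ x v) x ∂μ =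
      Real.exp (Module.finrank ℝ E * τ) * ∫ θ : sphere (0 : E) 1,
        (inner ℝ (Real.exp τ • (θ : E)) v / ‖Real.exp τ • (θ : E)‖ ^ 2 *
          φ (Real.exp τ • (θ : E))) ∂μ.toSphere := by
  set κ : E → ℝ := fun x => fderiv ℝ φ x v with hκ
  have hκc : Continuous κ :=
    (hφ.continuous_fderiv (by norm_num)).clm_apply continuous_const
  have hκs : HasCompactSupport κ := hφc.fderiv_apply ℝ v
  have hκi : Integrable κ μ := hκc.integrable_of_hasCompactSupport hκs
  have hφi : Integrable φ μ := hφ.continuous.integrable_of_hasCompactSupport hφc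
  set T := {p : E × ℝ | Real.log ‖p.1‖ < p.2} with hT
  have hTm : MeasurableSet T := measurableSet_lt (by fun_prop) (by fun_prop)
  have hind : ∀ x τ, {x : E | Real.log ‖x‖ < τ}.indicator κ x =
      T.indicator (fun p => κ p.1) (x, τ) := fun x τ => by
    simp only [indicator, hT]; congr 1
  have ham : StronglyMeasurable fun τ : ℝ => ∫ x, T.indicator (fun p => κ p.1) (x, τ) ∂μ := by
    refine StronglyMeasurable.integral_prod_left
      (f := fun x τ => T.indicator (fun p => κ p.1) (x, τ)) ?_
    exact (Measurable.indicator (hκc.measurable.comp measurable_fst) hTm).stronglyMeasurable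
  have hal : LocallyIntegrable fun τ : ℝ => ∫ x, T.indicator (fun p => κ p.1) (x, τ) ∂μ := by
    refine (locallyIntegrable_const (∫ x, ‖κ x‖ ∂μ)).mono ham.aestronglyMeasurable
      (Eventually.of_forall fun τ => ?_)
    refine (norm_integral_le_integral_norm _).trans ?_
    refine le_trans ?_ (le_abs_self _)
    refine integral_mono_of_nonneg (Eventually.of_forall fun x => norm_nonneg _) hκi.norm
      (Eventually.of_forall fun x => ?_)
    exact norm_indicator_le_norm_self (fun p : E × ℝ => κ p.1) (x, τ)
  set F : E → ℝ := fun x => inner ℝ (‖x‖⁻¹ • x) v * φ x with hF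
  have hFi : Integrable F μ := by
    refine hφi.bdd_mul (c := ‖v‖) (by fun_prop) (Eventually.of_forall fun x => ?_)
    refine (norm_inner_le_norm _ _).trans (mul_le_of_le_one_left (norm_nonneg _) ?_)
    rw [norm_smul, norm_inv, norm_norm]
    exact inv_mul_le_one
  have hFe : ∀ τ (θ : sphere (0 : E) 1),
      inner ℝ (Real.exp τ • (θ : E)) v / ‖Real.exp τ • (θ : E)‖ ^ 2 * φ (Real.exp τ • (θ : E)) =
        Real.exp (-τ) * F (Real.exp τ • (θ : E)) := fun τ θ => by
    simp only [hF]
    rw [norm_exp_smul_sphere, real_inner_smul_left (Real.exp τ • (θ : E)), Real.exp_neg]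
    have := Real.exp_pos τ
    field_simp
  have hbl : LocallyIntegrable fun τ : ℝ => Real.exp (Module.finrank ℝ E * τ) *
      ∫ θ : sphere (0 : E) 1, (inner ℝ (Real.exp τ • (θ : E)) v / ‖Real.exp τ • (θ : E)‖ ^ 2 *
          φ (Real.exp τ • (θ : E))) ∂μ.toSphere := by
    have h := ((locallyIntegrable_integral_sphere hFi).locallyIntegrableOn univ).continuousOn_mul
      (g := fun s => Real.exp (Module.finrank ℝ E * s) * Real.exp (-s)) (by fun_prop)
      isOpen_univ.isLocallyClosed
    rw [locallyIntegrableOn_univ] at h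
    refine h.congr (Eventually.of_forall fun s => ?_)
    simp only [hFe]
    rw [integral_const_mul, mul_assoc]
  simp_rw [hind]
  refine ae_eq_of_integral_contDiff_smul_eq hal hbl fun ψ hψ hψc => ?_
  -- Test `φ` against the radial function `η` whose profile is the primitive `P` of `ψ`.
  obtain ⟨P, hP, hPd, R, hR, hl, hr, hψ0⟩ := exists_primitive_of_hasCompactSupport hψ hψc
  have hψi : Integrable ψ := hψ.continuous.integrable_of_hasCompactSupport hψc
  set η : E → ℝ := logRadial P 0 with hη
  have hηs : ContDiff ℝ ∞ η := contDiff_logRadial hP hl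
  have hηd : ∀ x, fderiv ℝ η x v = ψ (Real.log ‖x‖) * inner ℝ x v / ‖x‖ ^ 2 := fun x =>
    fderiv_logRadial hPd hl x v
  have hne : ∀ᵐ x ∂μ, x ≠ (0 : E) := Measure.ae_ne μ 0
  have hηdc : Continuous fun x => fderiv ℝ η x v :=
    (hηs.continuous_fderiv (by norm_num)).clm_apply continuous_const
  -- By Fubini, the left-hand side is an integral over `x` of a tail integral of `ψ`.
  have hQ : Integrable (T.indicator fun p : E × ℝ => κ p.1 * ψ p.2) (μ.prod volume) :=
    (hκi.mul_prod hψi).indicator hTm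
  have e1 : ∫ τ, ψ τ • ∫ x, T.indicator (fun p => κ p.1) (x, τ) ∂μ =
      ∫ x, κ x * ((∫ t, ψ t) - P (Real.log ‖x‖)) ∂μ := by
    have h1 : ∀ τ, ψ τ • ∫ x, T.indicator (fun p => κ p.1) (x, τ) ∂μ =
        ∫ x, T.indicator (fun p : E × ℝ => κ p.1 * ψ p.2) (x, τ) ∂μ := fun τ => by
      rw [smul_eq_mul, ← integral_const_mul]
      refine integral_congr_ae (Eventually.of_forall fun x => ?_)
      simp only [indicator]
      split_ifs <;> ring
    simp_rw [h1]
    rw [← integral_integral_swap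
      (f := fun x τ => T.indicator (fun p : E × ℝ => κ p.1 * ψ p.2) (x, τ)) hQ]
    refine integral_congr_ae (Eventually.of_forall fun x => ?_)
    simp only
    have h2 : ∀ τ, T.indicator (fun p : E × ℝ => κ p.1 * ψ p.2) (x, τ) =
        κ x * (Ioi (Real.log ‖x‖)).indicator ψ τ := fun τ => by
      by_cases h : Real.log ‖x‖ < τ
      · rw [indicator_of_mem (show (x, τ) ∈ T from h), indicator_of_mem (mem_Ioi.2 h)]
      · rw [indicator_of_notMem (show (x, τ) ∉ T from h),
          indicator_of_notMem (fun h' => h (mem_Ioi.1 h')), mul_zero]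
    simp_rw [h2]
    rw [integral_const_mul, integral_indicator measurableSet_Ioi,
      integral_Ioi_of_hasDerivAt_of_tendsto hP.continuous.continuousWithinAt (fun t _ => hPd t)
        hψi.integrableOn (m := ∫ t, ψ t)]
    refine tendsto_const_nhds.congr' ?_
    filter_upwards [eventually_ge_atTop R] with t ht using (hr t ht).symm
  have e2 : ∫ x, κ x * ((∫ t, ψ t) - P (Real.log ‖x‖)) ∂μ = ∫ x, fderiv ℝ η x v * φ x ∂μ := by
    have i1 : Integrable (fun x => η x * κ x) μ :=
      (hηs.continuous.mul hκc).integrable_of_hasCompactSupport hκs.mul_left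
    have h1 : ∫ x, κ x * ((∫ t, ψ t) - P (Real.log ‖x‖)) ∂μ =
        ∫ x, (κ x * (∫ t, ψ t) - η x * κ x) ∂μ := by
      refine integral_congr_ae ?_
      filter_upwards [hne] with x hx
      rw [hη, logRadial_of_ne hx]; ring
    rw [h1, integral_sub (hκi.mul_const _) i1, integral_mul_const,
      integral_fderiv_eq_zero μ hφ hφc v, zero_mul, zero_sub, neg_eq_iff_eq_neg]
    exact integral_mul_fderiv_eq_neg_fderiv_mul_of_integrable
      ((hηdc.mul hφ.continuous).integrable_of_hasCompactSupport hφc.mul_left) i1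
      ((hηs.continuous.mul hφ.continuous).integrable_of_hasCompactSupport hφc.mul_left)
      (fun x _ => hηs.differentiable (by norm_num) x) (fun x _ => hφ.differentiable (by norm_num) x)
  have e3 : ∫ x, fderiv ℝ η x v * φ x ∂μ = ∫ τ, ψ τ • (Real.exp (Module.finrank ℝ E * τ) *
      ∫ θ : sphere (0 : E) 1, (inner ℝ (Real.exp τ • (θ : E)) v / ‖Real.exp τ • (θ : E)‖ ^ 2 *
          φ (Real.exp τ • (θ : E))) ∂μ.toSphere) := by
    have hi : Integrable (fun x => fderiv ℝ η x v * φ x) μ :=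
      (hηdc.mul hφ.continuous).integrable_of_hasCompactSupport hφc.mul_left
    rw [integral_eq_integral_exp_mul_integral_sphere hi]
    refine integral_congr_ae (Eventually.of_forall fun s => ?_)
    simp only [smul_eq_mul]
    rw [mul_left_comm, ← integral_const_mul (ψ s)]
    congr 1
    refine integral_congr_ae (Eventually.of_forall fun θ => ?_)
    simp only
    rw [hηd, norm_exp_smul_sphere, Real.log_exp]
    ring
  rw [e1, e2, e3]

end SphereFlux

section RadialGradient

variable {n : ℕ} {w u : ℝ → ℝ} {W : EuclideanSpace ℝ (Fin n) → ℝ}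

theorem norm_smul_div_norm_sq_self {E : Type*} [NormedAddCommGroup E] [NormedSpace ℝ E] (a : ℝ)
    {x : E} (hx : x ≠ 0) : ‖(a / ‖x‖ ^ 2) • x‖ = Real.exp (-Real.log ‖x‖) * |a| := by
  have h : 0 < ‖x‖ := norm_pos_iff.2 hx
  rw [norm_smul, Real.norm_eq_abs, abs_div, abs_of_pos (pow_pos h 2), Real.exp_neg, Real.exp_log h]
  field_simp

/-- A function which is absolutely continuous in `log ‖x‖` is weakly differentiable, also across the
origin, as soon as its radial derivative is integrable. -/
theorem hasWeakGradient_of_log_profile (hn : 1 ≤ n) (hu : Measurable u)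
    (hw : ∀ p q, w q - w p = ∫ t in p..q, u t)
    (hi : Integrable fun s => Real.exp ((n - 1) * s) * u s)
    (hW : ∀ x ≠ 0, W x = w (Real.log ‖x‖)) :
    HasWeakGradient W (fun x => (u (Real.log ‖x‖) / ‖x‖ ^ 2) • x) ∧
    Integrable (fun x : EuclideanSpace ℝ (Fin n) => (u (Real.log ‖x‖) / ‖x‖ ^ 2) • x) ∧
    ∫ x : EuclideanSpace ℝ (Fin n), ‖(u (Real.log ‖x‖) / ‖x‖ ^ 2) • x‖ =
      (volume : Measure (EuclideanSpace ℝ (Fin n))).toSphere.real univ *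
        ∫ s, Real.exp ((n - 1) * s) * |u s| := by
  have : Nonempty (Fin n) := ⟨⟨0, hn⟩⟩
  have hdim : Module.finrank ℝ (EuclideanSpace ℝ (Fin n)) = n := finrank_euclideanSpace_fin
  have hne : ∀ᵐ x : EuclideanSpace ℝ (Fin n), x ≠ 0 := Measure.ae_ne volume 0
  have hi' : Integrable fun s =>
      Real.exp ((Module.finrank ℝ (EuclideanSpace ℝ (Fin n)) - 1) * s) * u s := by
    rwa [hdim]
  set DM : EuclideanSpace ℝ (Fin n) → EuclideanSpace ℝ (Fin n) :=
    fun x => (u (Real.log ‖x‖) / ‖x‖ ^ 2) • x with hDM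
  have hDMm : AEStronglyMeasurable DM := by
    refine Measurable.aestronglyMeasurable ?_
    fun_prop
  set k : ℝ → ℝ := fun s => Real.exp (-s) * |u s| with hk
  have hexp : ∀ s, Real.exp (Module.finrank ℝ (EuclideanSpace ℝ (Fin n)) * s) * k s =
      Real.exp ((n - 1) * s) * |u s| := fun s => by
    simp only [hk]
    rw [← mul_assoc, ← Real.exp_add, hdim]
    congr 2; ring
  have hki : Integrable (fun x : EuclideanSpace ℝ (Fin n) => k (Real.log ‖x‖)) := by
    refine integrable_comp_log_norm (by fun_prop) ?_
    simp_rw [hexp]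
    refine hi.abs.congr (Eventually.of_forall fun s => ?_)
    simp only [abs_mul, Real.abs_exp]
  have hnorm : (fun x => ‖DM x‖) =ᵐ[volume] fun x => k (Real.log ‖x‖) := by
    filter_upwards [hne] with x hx using norm_smul_div_norm_sq_self _ hx
  have hDMi : Integrable DM := (integrable_norm_iff hDMm).1 (hki.congr hnorm.symm)
  refine ⟨⟨?_, hDMi.locallyIntegrable, ?_⟩, hDMi, ?_⟩
  · have hWball : ∀ S : ℝ, IntegrableOn W (ball 0 (Real.exp S)) := by
      intro S
      have hQ := (integrable_indicator_log_norm_lt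
        (μ := (volume : Measure (EuclideanSpace ℝ (Fin n)))) hu hi' (κ := fun _ => 1)
        measurable_const (B := 1) (by simp) S).integral_prod_left
      have h1 : IntegrableOn (fun x => w S - ∫ τ, {p : EuclideanSpace ℝ (Fin n) × ℝ |
          Real.log ‖p.1‖ < p.2 ∧ p.2 ≤ S}.indicator (fun p => u p.2 * 1) (x, τ))
          (ball 0 (Real.exp S)) :=
        (integrableOn_const measure_ball_lt_top.ne).sub hQ.integrableOn
      refine h1.congr ?_
      rw [EventuallyEq, ae_restrict_iff' measurableSet_ball]
      filter_upwards [hne] with x hx hxS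
      have hle : Real.log ‖x‖ ≤ S := by
        rw [Real.log_le_iff_le_exp (norm_pos_iff.2 hx)]
        exact (mem_ball_zero_iff.1 hxS).le
      rw [integral_indicator_log_norm_lt_right (u := u) (κ := fun _ => 1) x hle, hW x hx, ← hw]
      ring
    intro x
    refine ⟨ball 0 (Real.exp ‖x‖), isOpen_ball.mem_nhds ?_, hWball _⟩
    rw [mem_ball_zero_iff]
    linarith [Real.add_one_le_exp ‖x‖]
  · intro φ hφ hφc v
    set κ : EuclideanSpace ℝ (Fin n) → ℝ := fun x => fderiv ℝ φ x v with hκ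
    have hκc : Continuous κ :=
      (hφ.continuous_fderiv (by norm_num)).clm_apply continuous_const
    have hκs : HasCompactSupport κ := hφc.fderiv_apply ℝ v
    have hκi : Integrable κ := hκc.integrable_of_hasCompactSupport hκs
    obtain ⟨B, hB⟩ := hκc.bounded_above_of_compact_support hκs
    obtain ⟨Bφ, hBφ⟩ := hφ.continuous.bounded_above_of_compact_support hφc
    obtain ⟨R₁, -, hR₁⟩ := hκs.exists_pos_le_norm
    obtain ⟨R₂, -, hR₂⟩ := hφc.exists_pos_le_norm
    set S := max R₁ R₂ with hS
    have hfar : ∀ x : EuclideanSpace ℝ (Fin n), Real.exp S ≤ ‖x‖ → κ x = 0 ∧ φ x = 0 := by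
      intro x hx
      have h1 := Real.add_one_le_exp S
      have h2 := le_max_left R₁ R₂
      have h3 := le_max_right R₁ R₂
      exact ⟨hR₁ x (by linarith), hR₂ x (by linarith)⟩
    set Q : EuclideanSpace ℝ (Fin n) × ℝ → ℝ := {p : EuclideanSpace ℝ (Fin n) × ℝ |
      Real.log ‖p.1‖ < p.2 ∧ p.2 ≤ S}.indicator fun p => u p.2 * κ p.1 with hQdef
    have hQ : Integrable Q (volume.prod volume) :=
      integrable_indicator_log_norm_lt hu hi' hκc.measurable hB S
    -- `W x` is `w S` minus the integral of `u` from `log ‖x‖` to `S`, on the support of `κ`.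
    have e1 : ∫ x, W x * κ x = ∫ x, (w S * κ x - ∫ τ, Q (x, τ)) := by
      refine integral_congr_ae ?_
      filter_upwards [hne] with x hx
      rcases le_or_gt (Real.log ‖x‖) S with h | h
      · rw [hQdef, integral_indicator_log_norm_lt_right x h, hW x hx, ← hw]
        ring
      · have hx' : Real.exp S ≤ ‖x‖ := ((Real.lt_log_iff_exp_lt (norm_pos_iff.2 hx)).1 h).le
        have : ∀ τ, Q (x, τ) = 0 := fun τ => by
          simp [hQdef, indicator, (hfar x hx').1]
        simp [this, (hfar x hx').1]
    have e2 : ∫ x, W x * κ x = -∫ τ, ∫ x, Q (x, τ) := by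
      rw [e1, integral_sub (hκi.const_mul _) hQ.integral_prod_left, integral_const_mul,
        integral_fderiv_eq_zero volume hφ hφc v, mul_zero, zero_sub,
        integral_integral_swap (f := fun x τ => Q (x, τ)) hQ]
    rw [e2, neg_inj]
    have hRi : Integrable fun x => inner ℝ (DM x) v * φ x :=
      (hDMi.inner_const v).mul_bdd hφ.continuous.aestronglyMeasurable (Eventually.of_forall hBφ)
    rw [integral_eq_integral_exp_mul_integral_sphere hRi]
    refine integral_congr_ae ?_
    -- For almost every `τ`, the divergence theorem on the ball of radius `e ^ τ`.
    filter_upwards [ae_integral_log_norm_lt_fderiv volume hφ hφc v] with τ hτ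
    have e3 : ∀ θ : sphere (0 : EuclideanSpace ℝ (Fin n)) 1,
        inner ℝ (DM (Real.exp τ • (θ : EuclideanSpace ℝ (Fin n)))) v *
          φ (Real.exp τ • (θ : EuclideanSpace ℝ (Fin n))) =
        u τ * (inner ℝ (Real.exp τ • (θ : EuclideanSpace ℝ (Fin n))) v /
          ‖Real.exp τ • (θ : EuclideanSpace ℝ (Fin n))‖ ^ 2 *
          φ (Real.exp τ • (θ : EuclideanSpace ℝ (Fin n)))) := fun θ => by
      simp only [hDM]
      rw [real_inner_smul_left (Real.exp τ • (θ : EuclideanSpace ℝ (Fin n))),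
        norm_exp_smul_sphere, Real.log_exp]
      ring
    simp_rw [e3]
    rw [integral_const_mul, mul_left_comm, ← hτ]
    rcases le_or_gt τ S with h | h
    · rw [← integral_const_mul]
      refine integral_congr_ae (Eventually.of_forall fun x => ?_)
      simp only [hQdef, indicator, mem_ofPred_eq, h, and_true]
      split_ifs <;> ring
    · have h0 : ∀ x, Q (x, τ) = 0 := fun x =>
        indicator_of_notMem (fun h' => absurd h'.2 (not_le.2 h)) _
      have h1 : ∀ θ : sphere (0 : EuclideanSpace ℝ (Fin n)) 1,
          φ (Real.exp τ • (θ : EuclideanSpace ℝ (Fin n))) = 0 := fun θ =>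
        (hfar _ (by rw [norm_exp_smul_sphere]; exact Real.exp_le_exp.2 h.le)).2
      rw [hτ]
      simp [h0, h1]
  · rw [integral_congr_ae hnorm, integral_comp_log_norm hki]
    simp_rw [hexp]

end RadialGradient

/-! ### The restricted maximal function of a radial function -/

section RestrictedMaximal

variable {E : Type*} [NormedAddCommGroup E] [InnerProductSpace ℝ E] [FiniteDimensional ℝ E]
  [MeasurableSpace E] [BorelSpace E]

theorem setLIntegral_ball_eq (μ : Measure E) [μ.IsAddHaarMeasure] (z : E) {r : ℝ} (hr : 0 < r)
    {F : E → ℝ≥0∞} (hF : Measurable F) :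
    ∫⁻ y in ball z r, F y ∂μ = ENNReal.ofReal (r ^ Module.finrank ℝ E) *
      ∫⁻ y in ball (0 : E) 1, F (z + r • y) ∂μ := by
  set n := Module.finrank ℝ E
  set G : E → ℝ≥0∞ := (ball z r).indicator F with hG
  have hGm : Measurable G := hF.indicator measurableSet_ball
  have h1 : ∫⁻ y in ball (0 : E) 1, F (z + r • y) ∂μ = ∫⁻ y, G (z + r • y) ∂μ := by
    rw [← lintegral_indicator measurableSet_ball]
    refine lintegral_congr fun y => ?_
    have : z + r • y ∈ ball z r ↔ y ∈ ball (0 : E) 1 := by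
      simp [norm_smul, abs_of_pos hr, hr]
    by_cases hy : y ∈ ball (0 : E) 1
    · rw [indicator_of_mem hy, hG, indicator_of_mem (this.2 hy)]
    · rw [indicator_of_notMem hy, hG, indicator_of_notMem (fun h => hy (this.1 h))]
  have h2 : ∫⁻ y, G (z + r • y) ∂μ = ENNReal.ofReal ((r ^ n)⁻¹) * ∫⁻ y, G y ∂μ := by
    rw [← lintegral_map (f := fun w => G (z + w)) (g := (r • · : E → E)) (by fun_prop)
      (by fun_prop), Measure.map_addHaar_smul μ hr.ne', lintegral_smul_measure,
      lintegral_add_left_eq_self G z, abs_of_pos (by positivity)]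
    rfl
  rw [h1, h2, ← mul_assoc, ← ENNReal.ofReal_mul (by positivity), mul_inv_cancel₀ (by positivity),
    ENNReal.ofReal_one, one_mul, hG, lintegral_indicator measurableSet_ball]

/-- The averages of `|f|` over balls are the logarithmic averages of its profile. -/
theorem setLAverage_ball_eq_logAverage [Nontrivial E] {μ : Measure E} [μ.IsAddHaarMeasure]
    {f : E → ℝ} {Γ : ℝ → ℝ} (hΓ : Continuous Γ) (hΓ0 : ∀ t, 0 ≤ Γ t)
    (hf : ∀ᵐ y ∂μ, |f y| = Γ (Real.log ‖y‖)) (s : ℝ) {κ : E × ℝ}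
    (hκ : κ ∈ admissibleBalls E 0) (hρ : 0 < κ.2) :
    ⨍⁻ y in ball (Real.exp s • κ.1) (Real.exp s * κ.2), ‖f y‖ₑ ∂μ =
      ENNReal.ofReal (logAverage μ Γ s κ) := by
  have : ProperSpace E := FiniteDimensional.proper ℝ E
  have hr : 0 < Real.exp s * κ.2 := by positivity
  have hball : (ball (0 : E) 1 : Set E) =ᵐ[μ] closedBall (0 : E) 1 := by
    refine ae_eq_of_subset_of_measure_ge ball_subset_closedBall ?_
      measurableSet_ball.nullMeasurableSet measure_closedBall_lt_top.ne
    rw [Measure.addHaar_closedBall_eq_addHaar_ball]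
  have hvol : μ (ball (Real.exp s • κ.1) (Real.exp s * κ.2)) =
      ENNReal.ofReal ((Real.exp s * κ.2) ^ Module.finrank ℝ E) * μ (closedBall (0 : E) 1) := by
    rw [Measure.addHaar_ball μ _ hr.le, measure_congr hball]
  rw [logAverage, ofReal_setAverage (integrableOn_comp_logShift hΓ s κ)
    (Eventually.of_forall fun y => hΓ0 _), setLAverage_eq, hvol]
  have h1 : ∫⁻ y in ball (Real.exp s • κ.1) (Real.exp s * κ.2), ‖f y‖ₑ ∂μ =
      ∫⁻ y in ball (Real.exp s • κ.1) (Real.exp s * κ.2), ENNReal.ofReal (Γ (Real.log ‖y‖)) ∂μ := by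
    refine lintegral_congr_ae (ae_restrict_of_ae ?_)
    filter_upwards [hf] with y hy
    rw [← hy, ← Real.enorm_eq_ofReal_abs]
  have h2 : ∫⁻ y in ball (0 : E) 1,
      ENNReal.ofReal (Γ (Real.log ‖Real.exp s • κ.1 + (Real.exp s * κ.2) • y‖)) ∂μ =
      ∫⁻ y in closedBall (0 : E) 1, ENNReal.ofReal (Γ (s + logShift κ y)) ∂μ := by
    rw [setLIntegral_congr hball]
    refine setLIntegral_congr_fun measurableSet_closedBall fun y hy => ?_
    have hN := half_le_norm_add_smul hκ hy
    rw [logShift_eq hκ hy, mul_smul, ← smul_add, norm_smul, Real.norm_eq_abs, Real.abs_exp,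
      Real.log_mul (Real.exp_pos _).ne' (by positivity), Real.log_exp]
  rw [h1, setLIntegral_ball_eq μ _ hr (F := fun y => ENNReal.ofReal (Γ (Real.log ‖y‖)))
    (hΓ.measurable.comp (by fun_prop)).ennreal_ofReal, h2]
  exact ENNReal.mul_div_mul_left _ _ (ENNReal.ofReal_pos.2 (by positivity)).ne'
    ENNReal.ofReal_ne_top

/-- Rotation invariance: a reflection exchanges two centres of equal norm. -/
theorem logAverage_eq_of_norm_eq (Γ : ℝ → ℝ) (s : ℝ) {ζ ζ' : E} (h : ‖ζ‖ = ‖ζ'‖) (ρ : ℝ) :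
    logAverage volume Γ s (ζ, ρ) = logAverage volume Γ s (ζ', ρ) := by
  set L : E ≃ₗᵢ[ℝ] E := (ℝ ∙ (ζ - ζ'))ᗮ.reflection
  have hL : L ζ = ζ' := Submodule.reflection_sub h
  simp only [logAverage, setAverage_eq]
  congr 1
  have := L.measurePreserving.setIntegral_preimage_emb L.toHomeomorph.measurableEmbedding
    (fun y => Γ (s + logShift (ζ', ρ) y)) (closedBall (0 : E) 1)
  rw [← this]
  have h2 : L ⁻¹' closedBall (0 : E) 1 = closedBall 0 1 := by
    ext y; simp
  rw [h2]
  refine integral_congr_ae (Eventually.of_forall fun y => ?_)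
  simp only [logShift]
  rw [← hL, ← map_smul, ← map_add, L.norm_map]

end RestrictedMaximal

section Euclidean

variable {n : ℕ} {f : EuclideanSpace ℝ (Fin n) → ℝ} {Γ : ℝ → ℝ}

theorem restrictedMaximal_zero : restrictedMaximal f 0 = 0 := by
  simp only [restrictedMaximal, ENNReal.iSup_eq_zero]
  intro z r hx hr
  rw [norm_zero, zero_div] at hr
  exact absurd (pos_of_mem_ball hx) hr.not_gt

/-- Balls whose closure touches the sphere of radius `‖x‖` may be used in the maximal function at
`x`, after a rotation and a limit of balls that contain `x`. -/
theorem ofReal_logAverage_le_restrictedMaximal [Nontrivial (EuclideanSpace ℝ (Fin n))]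
    (hΓ : Continuous Γ) (hΓ0 : ∀ t, 0 ≤ Γ t) (hf : ∀ᵐ y, |f y| = Γ (Real.log ‖y‖))
    {x : EuclideanSpace ℝ (Fin n)} (hx : x ≠ 0) {κ : EuclideanSpace ℝ (Fin n) × ℝ}
    (hκ : κ ∈ admissibleBalls _ 0) :
    ENNReal.ofReal (logAverage volume Γ (Real.log ‖x‖) κ) ≤ restrictedMaximal f x := by
  have hx0 : 0 < ‖x‖ := norm_pos_iff.2 hx
  set s := Real.log ‖x‖ with hs
  have hes : Real.exp s = ‖x‖ := Real.exp_log hx0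
  set e := ‖x‖⁻¹ • x with he
  have he1 : ‖e‖ = 1 := by rw [he, norm_smul, norm_inv, norm_norm, inv_mul_cancel₀ hx0.ne']
  set a := ‖κ.1‖ with ha
  have hk0 := nonneg_of_mem_admissibleBalls hκ
  -- After a rotation, the centre is a multiple of `x`. The closed ball may only touch the sphere
  -- through `x`, or be a point, but its convex combinations with the ball of relative radius
  -- `1 / 4` centred at `x` have `x` in their interior.
  set κ' : ℝ → EuclideanSpace ℝ (Fin n) × ℝ := fun l =>
    (((1 - l) * a + l) • e, (1 - l) * κ.2 + l * (1 / 4)) with hκ'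
  have h0 : logAverage volume Γ s κ = logAverage volume Γ s (κ' 0) := by
    simp only [hκ', sub_zero, one_mul, add_zero, zero_mul]
    exact logAverage_eq_of_norm_eq Γ s (by simp [norm_smul, he1, ha]) κ.2
  have hcont : Continuous fun l => ENNReal.ofReal (logAverage volume Γ s (κ' l)) := by
    refine ENNReal.continuous_ofReal.comp
      ((continuous_logAverage hΓ).comp (f := fun l => (s, κ' l)) ?_)
    simp only [hκ']
    fun_prop
  rw [h0]
  refine le_of_tendsto (x := 𝓝[>] (0 : ℝ)) ((hcont.tendsto 0).mono_left nhdsWithin_le_nhds) ?_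
  filter_upwards [Ioo_mem_nhdsGT (zero_lt_one' ℝ)] with l hl
  have hb := hκ.1
  have hlt : |(1 - l) * a + l - 1| < (1 - l) * κ.2 + l * (1 / 4) := by
    have : (1 - l) * a + l - 1 = (1 - l) * (a - 1) := by ring
    rw [this, abs_mul, abs_of_pos (by linarith [hl.2])]
    have := mul_le_mul_of_nonneg_left hb (sub_nonneg.2 hl.2.le)
    linarith [hl.1]
  have hρ : 0 < (κ' l).2 := (abs_nonneg _).trans_lt hlt
  have hρ4 : (κ' l).2 ≤ 1 / 4 := by
    have := mul_le_mul_of_nonneg_left hκ.2.2 (sub_nonneg.2 hl.2.le)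
    simp only [hκ']; linarith
  have hpos : 0 ≤ (1 - l) * a + l :=
    add_nonneg (mul_nonneg (by linarith [hl.2]) (norm_nonneg _)) hl.1.le
  have hadm : κ' l ∈ admissibleBalls (EuclideanSpace ℝ (Fin n)) 0 := by
    refine ⟨?_, hρ.le, hρ4⟩
    simp only [hκ', norm_smul, he1, mul_one, Real.norm_eq_abs, abs_of_nonneg hpos]
    exact hlt.le
  rw [← setLAverage_ball_eq_logAverage hΓ hΓ0 hf s hadm hρ, restrictedMaximal]
  refine le_iSup₂_of_le _ _ (le_iSup₂_of_le ?_ ?_ le_rfl)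
  · have hxe : x = ‖x‖ • e := by rw [he, smul_inv_smul₀ hx0.ne']
    rw [mem_ball_iff_norm, hes]
    nth_rewrite 1 [hxe]
    rw [← smul_sub, norm_smul, norm_norm]
    refine mul_lt_mul_of_pos_left ?_ hx0
    have : e - (κ' l).1 = -(((1 - l) * a + l - 1) • e) := by simp only [hκ']; module
    rwa [this, norm_neg, norm_smul, he1, mul_one]
  · rw [hes]
    have := mul_le_mul_of_nonneg_left hρ4 hx0.le
    linarith

theorem restrictedMaximal_eq_ofReal_logMaximal [Nontrivial (EuclideanSpace ℝ (Fin n))]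
    (hΓ : Continuous Γ) (hΓ0 : ∀ t, 0 ≤ Γ t) (hf : ∀ᵐ y, |f y| = Γ (Real.log ‖y‖))
    {x : EuclideanSpace ℝ (Fin n)} (hx : x ≠ 0) :
    restrictedMaximal f x = ENNReal.ofReal
      (logMaximal (volume : Measure (EuclideanSpace ℝ (Fin n))) Γ 0 (Real.log ‖x‖)) := by
  have hx0 : 0 < ‖x‖ := norm_pos_iff.2 hx
  refine le_antisymm ?_ ?_
  · simp only [restrictedMaximal, iSup_le_iff]
    intro z r hxz hr
    have hr0 := pos_of_mem_ball hxz
    have hκ : ((‖x‖⁻¹ • z, ‖x‖⁻¹ * r) : EuclideanSpace ℝ (Fin n) × ℝ) ∈ admissibleBalls _ 0 := by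
      refine ⟨?_, by positivity, ?_⟩
      · simp only [norm_smul, norm_inv, norm_norm]
        have : ‖x‖⁻¹ * ‖z‖ - 1 = ‖x‖⁻¹ * (‖z‖ - ‖x‖) := by field_simp
        rw [this, abs_mul, abs_of_pos (inv_pos.2 hx0)]
        refine mul_le_mul_of_nonneg_left ?_ (inv_pos.2 hx0).le
        rw [mem_ball_comm, mem_ball_iff_norm] at hxz
        exact (abs_norm_sub_norm_le _ _).trans hxz.le
      · rw [inv_mul_le_iff₀ hx0]; linarith
    have := setLAverage_ball_eq_logAverage hΓ hΓ0 hf (Real.log ‖x‖) hκ (by positivity)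
    simp only [Real.exp_log hx0, smul_inv_smul₀ hx0.ne', mul_inv_cancel_left₀ hx0.ne'] at this
    rw [this]
    exact ENNReal.ofReal_le_ofReal (logAverage_le_logMaximal hΓ hκ)
  · obtain ⟨κ, hκ, he⟩ := exists_logMaximal_eq (E := EuclideanSpace ℝ (Fin n)) (μ := volume) hΓ
      (by norm_num : (0 : ℝ) ≤ 1 / 4) (Real.log ‖x‖)
    rw [he]
    exact ofReal_logAverage_le_restrictedMaximal hΓ hΓ0 hf hx hκ

end Euclidean

/-! ### Summation over unit intervals -/

theorem tsum_setLIntegral_Ioc_intCast (F : ℝ → ℝ≥0∞) :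
    ∑' k : ℤ, ∫⁻ s in Ioc (k : ℝ) (k + 1), F s = ∫⁻ s, F s := by
  rw [← lintegral_iUnion (fun _ => measurableSet_Ioc) (pairwise_disjoint_Ioc_intCast ℝ),
    iUnion_Ioc_intCast, Measure.restrict_univ]

theorem tsum_setLIntegral_Ioc_intCast_sub_two_add_three_le (F : ℝ → ℝ≥0∞) :
    ∑' k : ℤ, ∫⁻ s in Ioc ((k : ℝ) - 2) (k + 3), F s ≤ 5 * ∫⁻ s, F s := by
  have h1 : ∀ k : ℤ, ∫⁻ s in Ioc ((k : ℝ) - 2) (k + 3), F s ≤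
      ∑' i : Fin 5, ∫⁻ s in
        Ioc ((k + ((i : ℤ) - 2) : ℤ) : ℝ) ((k + ((i : ℤ) - 2) : ℤ) + 1), F s := by
    intro k
    refine le_trans (lintegral_mono_set fun s hs => ?_) (lintegral_iUnion_le _ _)
    -- The interval containing `s` has left end `⌈s⌉ - 1`.
    have h2 : k - 2 < ⌈s⌉ := by
      rw [Int.lt_ceil]; push_cast; exact hs.1
    have h3 : ⌈s⌉ ≤ k + 3 := by
      rw [Int.ceil_le]; push_cast; exact hs.2
    refine mem_iUnion.2 ⟨⟨(⌈s⌉ - 1 - (k - 2)).toNat, by omega⟩, ?_⟩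
    have h4 : (k + ((((⌈s⌉ - 1 - (k - 2)).toNat : ℕ) : ℤ) - 2) : ℤ) = ⌈s⌉ - 1 := by omega
    simp only [h4]
    push_cast
    exact ⟨by linarith [Int.ceil_lt_add_one s], by linarith [Int.le_ceil s]⟩
  refine (ENNReal.tsum_le_tsum h1).trans ?_
  rw [ENNReal.tsum_comm]
  have h2 : ∀ i : Fin 5, ∑' k : ℤ, ∫⁻ s in
      Ioc ((k + ((i : ℤ) - 2) : ℤ) : ℝ) ((k + ((i : ℤ) - 2) : ℤ) + 1), F s =
        ∫⁻ s, F s := fun i => by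
    rw [← tsum_setLIntegral_Ioc_intCast F]
    exact (Equiv.addRight ((i : ℤ) - 2)).tsum_eq
      fun k : ℤ => ∫⁻ s in Ioc (k : ℝ) (k + 1), F s
  simp only [h2, tsum_fintype, Finset.sum_const, Finset.card_univ, Fintype.card_fin, nsmul_eq_mul]
  norm_num

/-- The exponential weight is essentially constant on intervals of bounded length, so that bounds on
unit intervals sum up to a weighted bound on the line. -/
theorem lintegral_exp_mul_le_of_forall_Icc {m C : ℝ} (hm : 0 ≤ m) (hC : 0 ≤ C)
    {u g : ℝ → ℝ} (hg : LocallyIntegrable g volume)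
    (hg0 : ∀ x, 0 ≤ g x)
    (h : ∀ a, ∫⁻ x in Icc a (a + 1), ‖u x‖ₑ ≤
      ENNReal.ofReal (C * ∫ x in (a - 2)..(a + 3), g x)) :
    ∫⁻ s, ‖Real.exp (m * s) * u s‖ₑ ≤
      ENNReal.ofReal (5 * (C * Real.exp (3 * m))) *
        ∫⁻ s, ENNReal.ofReal (Real.exp (m * s) * g s) := by
  have hk : ∀ k : ℤ, ∫⁻ s in Ioc (k : ℝ) (k + 1), ‖Real.exp (m * s) * u s‖ₑ ≤
      ENNReal.ofReal (C * Real.exp (3 * m)) *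
        ∫⁻ s in Ioc ((k : ℝ) - 2) (k + 3), ENNReal.ofReal (Real.exp (m * s) * g s) := fun k => by
    calc ∫⁻ s in Ioc (k : ℝ) (k + 1), ‖Real.exp (m * s) * u s‖ₑ
        ≤ ∫⁻ s in Ioc (k : ℝ) (k + 1), ENNReal.ofReal (Real.exp (m * (k + 1))) * ‖u s‖ₑ := by
          refine setLIntegral_mono' measurableSet_Ioc fun s hs => ?_
          rw [enorm_mul, Real.enorm_eq_ofReal (Real.exp_pos _).le]
          gcongr
          exact hs.2
      _ = ENNReal.ofReal (Real.exp (m * (k + 1))) * ∫⁻ s in Ioc (k : ℝ) (k + 1), ‖u s‖ₑ :=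
          lintegral_const_mul' _ _ ENNReal.ofReal_ne_top
      _ ≤ ENNReal.ofReal (Real.exp (m * (k + 1))) *
            ENNReal.ofReal (C * ∫ x in ((k : ℝ) - 2)..(k + 3), g x) := by
          gcongr
          exact (lintegral_mono_set Ioc_subset_Icc_self).trans (h k)
      _ = ENNReal.ofReal C * ∫⁻ s in Ioc ((k : ℝ) - 2) (k + 3),
            ENNReal.ofReal (Real.exp (m * (k + 1))) * ENNReal.ofReal (g s) := by
          rw [ENNReal.ofReal_mul hC, ofReal_intervalIntegral_eq_setLIntegral (by linarith)
            (hg.integrableOn_isCompact isCompact_Icc) hg0, setLIntegral_congr Ioc_ae_eq_Icc.symm,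
            lintegral_const_mul' _ _ ENNReal.ofReal_ne_top]
          ring
      _ ≤ ENNReal.ofReal C * ∫⁻ s in Ioc ((k : ℝ) - 2) (k + 3),
            ENNReal.ofReal (Real.exp (3 * m)) * ENNReal.ofReal (Real.exp (m * s) * g s) := by
          gcongr ENNReal.ofReal C * ?_
          refine setLIntegral_mono' measurableSet_Ioc fun s hs => ?_
          rw [← ENNReal.ofReal_mul (Real.exp_pos _).le, ← ENNReal.ofReal_mul (Real.exp_pos _).le,
            ← mul_assoc, ← Real.exp_add]
          refine ENNReal.ofReal_le_ofReal
            (mul_le_mul_of_nonneg_right (Real.exp_le_exp.2 ?_) (hg0 s))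
          nlinarith [hs.1]
      _ = _ := by
          rw [lintegral_const_mul' _ _ ENNReal.ofReal_ne_top, ENNReal.ofReal_mul hC, mul_assoc]
  rw [← tsum_setLIntegral_Ioc_intCast]
  refine (ENNReal.tsum_le_tsum hk).trans ?_
  rw [ENNReal.tsum_mul_left, ENNReal.ofReal_mul (by norm_num : (0 : ℝ) ≤ 5),
    mul_comm (ENNReal.ofReal 5), mul_assoc]
  gcongr
  simpa using tsum_setLIntegral_Ioc_intCast_sub_two_add_three_le _

theorem integrable_exp_mul_of_forall_Icc {m C : ℝ} (hm : 0 ≤ m) (hC : 0 ≤ C)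
    {u g : ℝ → ℝ} (hu : Measurable u) (hg : LocallyIntegrable g volume)
    (hg0 : ∀ x, 0 ≤ g x)
    (h : ∀ a, ∫⁻ x in Icc a (a + 1), ‖u x‖ₑ ≤
      ENNReal.ofReal (C * ∫ x in (a - 2)..(a + 3), g x))
    (hi : Integrable fun s => Real.exp (m * s) * g s) :
    (Integrable fun s => Real.exp (m * s) * u s) ∧
      ∫ s, Real.exp (m * s) * |u s| ≤
        5 * (C * Real.exp (3 * m)) * ∫ s, Real.exp (m * s) * g s := by
  have h1 := lintegral_exp_mul_le_of_forall_Icc hm hC hg hg0 h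
  have h0 : ∀ s, 0 ≤ Real.exp (m * s) * g s := fun s => mul_nonneg (Real.exp_pos _).le (hg0 s)
  rw [← ofReal_integral_eq_lintegral_ofReal hi (Eventually.of_forall h0),
    ← ENNReal.ofReal_mul (by positivity)] at h1
  have hI : Integrable fun s => Real.exp (m * s) * u s :=
    ⟨by fun_prop, h1.trans_lt ENNReal.ofReal_lt_top⟩
  refine ⟨hI, ?_⟩
  have h2 : ∫ s, Real.exp (m * s) * |u s| = ∫ s, ‖Real.exp (m * s) * u s‖ := by
    simp
  rw [h2, integral_norm_eq_lintegral_enorm hI.aestronglyMeasurable]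
  exact ENNReal.toReal_le_of_le_ofReal (mul_nonneg (by positivity) (integral_nonneg h0)) h1

/-! ### The gradient bound -/

/-- The maximal function of a radial function is finite everywhere, since it is determined by a
continuous profile away from the origin, and vanishes at the origin for lack of balls. -/
theorem exists_hasWeakGradient_restrictedMaximal {n : ℕ} (hn : 1 ≤ n) :
    ∃ C : ℝ, ∀ (f : EuclideanSpace ℝ (Fin n) → ℝ)
      (Df : EuclideanSpace ℝ (Fin n) → EuclideanSpace ℝ (Fin n)),
      Integrable f volume → HasWeakGradient f Df → Integrable Df volume → IsRadial f →
      (∀ x, restrictedMaximal f x < ⊤) ∧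
      ∃ DM : EuclideanSpace ℝ (Fin n) → EuclideanSpace ℝ (Fin n),
        HasWeakGradient (fun x => (restrictedMaximal f x).toReal) DM ∧
        Integrable DM volume ∧
        (∫ x, ‖DM x‖) ≤ C * (∫ x, ‖Df x‖) := by
  have : Nonempty (Fin n) := ⟨⟨0, hn⟩⟩
  set μ := (volume : Measure (EuclideanSpace ℝ (Fin n))) with hμ
  obtain ⟨C, hC, hcore⟩ := exists_logMaximal_sub_eq_integral μ
  have hm : (0 : ℝ) ≤ n - 1 := by
    rw [sub_nonneg]; exact_mod_cast hn
  refine ⟨5 * (C * Real.exp (3 * (n - 1))), fun f Df hf hw hDf hr => ?_⟩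
  obtain ⟨c, γ, hγ, hγl, hfγ, hγi, hγD⟩ := hw.exists_log_profile hn hf hDf hr
  have hint : ∀ a b, IntervalIntegrable γ volume a b := fun a b =>
    (intervalIntegrable_iff').2 (hγl.integrableOn_isCompact isCompact_uIcc)
  set Γ : ℝ → ℝ := fun s => |c + ∫ t in (0 : ℝ)..s, γ t| with hΓdef
  have hΓ : Continuous Γ :=
    (continuous_const.add (intervalIntegral.continuous_primitive hint 0)).abs
  have hΓ0 : ∀ t, 0 ≤ Γ t := fun t => abs_nonneg _
  have hfΓ : ∀ᵐ y ∂μ, |f y| = Γ (Real.log ‖y‖) := by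
    filter_upwards [hfγ] with y hy
    rw [hy]
  have hg0 : ∀ x, 0 ≤ |γ x| := fun x => abs_nonneg _
  have hΓg : ∀ p q, p ≤ q → |Γ q - Γ p| ≤ ∫ x in p..q, |γ x| := fun p q hpq => by
    refine (abs_abs_sub_abs_le_abs_sub _ _).trans ?_
    rw [add_sub_add_left_eq_sub, intervalIntegral.integral_interval_sub_left (hint _ _) (hint _ _)]
    exact intervalIntegral.abs_integral_le_integral_abs hpq
  have hγl' : LocallyIntegrable (fun x => |γ x|) :=
    fun x => (hγl x).norm
  obtain ⟨u, hu, hul, huw, hub⟩ := hcore Γ (fun x => |γ x|) hΓ (by fun_prop) hγl' hg0 hΓg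
  have hi : Integrable fun s => Real.exp ((n - 1) * s) * |γ s| := by
    simpa [abs_mul] using hγi.abs
  obtain ⟨hui, hule⟩ := integrable_exp_mul_of_forall_Icc hm hC hu hγl' hg0 hub hi
  have hM : ∀ x ≠ 0, restrictedMaximal f x = ENNReal.ofReal (logMaximal μ Γ 0 (Real.log ‖x‖)) :=
    fun x hx => restrictedMaximal_eq_ofReal_logMaximal hΓ hΓ0 hfΓ hx
  have hMr : ∀ x ≠ 0, (restrictedMaximal f x).toReal = logMaximal μ Γ 0 (Real.log ‖x‖) :=
    fun x hx => by
      rw [hM x hx, ENNReal.toReal_ofReal ((hΓ0 _).trans (le_logMaximal hΓ _))]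
  obtain ⟨h1, h2, h3⟩ := hasWeakGradient_of_log_profile hn hu huw hui hMr
  refine ⟨fun x => ?_, _, h1, h2, ?_⟩
  · rcases eq_or_ne x 0 with rfl | hx
    · simp [restrictedMaximal_zero]
    · rw [hM x hx]; exact ENNReal.ofReal_lt_top
  · rw [h3]
    calc _ ≤ μ.toSphere.real univ * (5 * (C * Real.exp (3 * (n - 1))) *
          ∫ s, Real.exp ((n - 1) * s) * |γ s|) := by gcongr
      _ = 5 * (C * Real.exp (3 * (n - 1))) * (μ.toSphere.real univ *
          ∫ s, Real.exp ((n - 1) * s) * |γ s|) := by ring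
      _ ≤ _ := by gcongr

end

theorem mainTheorem2 (n : ℕ) (hn : 1 ≤ n) :
    ∃ C : ℝ, ∀ (f : EuclideanSpace ℝ (Fin n) → ℝ)
      (Df : EuclideanSpace ℝ (Fin n) → EuclideanSpace ℝ (Fin n)),
      Integrable f volume → HasWeakGradient f Df → Integrable Df volume → IsRadial f →
      (∀ᵐ x : EuclideanSpace ℝ (Fin n), restrictedMaximal f x < ⊤) ∧
      ∃ DM : EuclideanSpace ℝ (Fin n) → EuclideanSpace ℝ (Fin n),
        HasWeakGradient (fun x => (restrictedMaximal f x).toReal) DM ∧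
        Integrable DM volume ∧
        (∫ x, ‖DM x‖) ≤ C * (∫ x, ‖Df x‖) := by
  obtain ⟨C, hC⟩ := exists_hasWeakGradient_restrictedMaximal hn
  refine ⟨C, fun f Df hf hw hDf hr => ?_⟩
  obtain ⟨hfin, hDM⟩ := hC f Df hf hw hDf hr
  exact ⟨Filter.Eventually.of_forall hfin, hDM⟩
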